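/- **Setting.** Let $D\subset\widetilde D\subset\mathbb R^3$ be bounded open polyhedral sets and let $\mathbb T_h$ be a conforming tetrahedrization of $\widetilde D$ (a finite simplicial complex, all of whose faces are faces of tetrahedra, whose underlying set has interior $\widetilde D$) of maximal mesh-size $h$ (the largest diameter of a tetrahedron), such that its restriction $\mathbb T_h|_D$ (the faces contained in $\overline D$) is a tetrahedrization of $D$. Assume that $\mathbb T_h$ is regular with constant $\kappa>0$: each tetrahedron of $\mathbb T_h$ contains a ball of radius $\kappa h$. Let $x_1,\dots,x_N$ be the vertices of $\mathbb T_h|_D$, let $\mathbb V_h$ be the space of continuous functions $\overline D\to\mathbb R^3$ that are affine on each tetrahedron of $\mathbb T_h|_D$, and let $\phi_n$ be the scalar continuous piecewise affine functions with $\phi_n(x_m)=\delta_{nm}$. Assume $\int_D\nabla\phi_i\cdot\nabla\phi_j\,dx\le 0$ for all $i\ne j$. Let $\mathbb Y_h$ be the lowest order edge element space of Nédélec's first family on $\mathbb T_h$: the fields of the form $a_K+b_K\times x$ ($a_K,b_K\in\mathbb R^3$) on each tetrahedron $K$ whose integrals $\int_e \psi\cdot\tau\,ds$ over the edges $e$ (with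 unit tangent $\tau$) are single-valued, i.e. agree for all tetrahedra that contain $e$. Write $\langle\cdot,\cdot\rangle_\Omega$ and $\|\cdot\|_\Omega$ for the inner product and norm of $L^2(\Omega)$. Let $\lambda_1\neq0$, $\lambda_2>0$, $\sigma\ge0$, $\mu_0>0$, $\mu=\lambda_1^2+\lambda_2^2$, $\theta\in[0,1]$, $T>0$, let $J$ be a positive integer and $k=T/J$. Let $m_0:\overline D\to\mathbb R^3$ be continuous with $|m_0|=1$ a.e. in $D$, and let $H_0$ be a field on the closure of $\widetilde D$ whose tangential component is integrable along each edge of $\mathbb T_h$. **Scheme.** Let $m_h^{(0)}\in\mathbb V_h$ be the nodal interpolant of $m_0$, and let $H_h^{(0)}\in\mathbb Y_h$ be the edge interpolant of $H_0$ (the element with the same edge integrals as $H_0$). For $j=0,\dots,J-1$ let $\mathbb W_h^{(j)}=\{w\in\mathbb V_h: w(x_n)\cdot m_h^{(j)}(x_n)=0,\ n=1,\dots,N\}$, and let $(v_h^{(j+1)},H_h^{(j+1)})\in\mathbb W_h^{(j)}\times\mathbb Y_h$ satisfy, with $H_h^{(j+1/2)}=\tfrac12(H_h^{(j+1)}+H_h^{(j)})$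 and $d_tH_h^{(j+1)}=k^{-1}(H_h^{(j+1)}-H_h^{(j)})$, $$\lambda_2\langle v_h^{(j+1)},w\rangle_D-\lambda_1\langle m_h^{(j)}\times v_h^{(j+1)},w\rangle_D=-\mu\langle\nabla(m_h^{(j)}+k\theta v_h^{(j+1)}),\nabla w\rangle_D+\mu\langle H_h^{(j+1/2)},w\rangle_D\quad\forall w\in\mathbb W_h^{(j)},$$ $$\mu_0\langle d_tH_h^{(j+1)},\zeta\rangle_{\widetilde D}+\sigma\langle\nabla\times H_h^{(j+1/2)},\nabla\times\zeta\rangle_{\widetilde D}=-\mu_0\langle v_h^{(j+1)},\zeta\rangle_{\widetilde D}\quad\forall\zeta\in\mathbb Y_h,$$ where $v_h^{(j+1)}$ is extended by zero outside $D$; then set $$m_h^{(j+1)}=\sum_{n=1}^N\frac{m_h^{(j)}(x_n)+kv_h^{(j+1)}(x_n)}{|m_h^{(j)}(x_n)+kv_h^{(j+1)}(x_n)|}\,\phi_n .$$ **Lemma.** There is a constant $C_1>0$, depending only on $\kappa$ (in particular independent of $j$, $k$ and $h$), such that for all such data and all $j=0,1,\dots,J$ $$\mathcal E_h^{(j)}+C\sum_{i=0}^{j-1}k\|v_h^{(i+1)}\|_D^2+\lambda_2\mu^{-1}\sum_{i=0}^{j-1}k\|d_tH_h^{(i+1)}\|_{\widetilde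 D}^2+2\mu_0^{-1}\sigma\sum_{i=0}^{j-1}k\|\nabla\times H_h^{(i+1/2)}\|_{\widetilde D}^2\le\mathcal E_h^{(0)},$$ where $$\mathcal E_h^{(j)}=\|\nabla m_h^{(j)}\|_D^2+\|H_h^{(j)}\|_{\widetilde D}^2+\lambda_2\mu^{-1}\mu_0^{-1}\sigma\|\nabla\times H_h^{(j)}\|_{\widetilde D}^2$$ and $$C=\begin{cases}\lambda_2\mu^{-1},&\theta\in[\tfrac12,1],\\ \lambda_2\mu^{-1}-(1-2\theta)C_1kh^{-2},&\theta\in[0,\tfrac12).\end{cases}$$ -/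

import Mathlib

namespace MLLG

open MeasureTheory

/-- Three-dimensional Euclidean space. -/
abbrev R3 := EuclideanSpace ℝ (Fin 3)

/-- The cross product `u × v`. -/
noncomputable def cross (u v : R3) : R3 :=
  WithLp.toLp 2 (crossProduct (WithLp.ofLp u) (WithLp.ofLp v))

/-! ### Differential operators and `L²` products

For the finite element functions below (affine, resp. of the form `a + b × x`, on each cell) the
weak gradient and the weak curl are the classical ones, computed inside the cells; the union of the
boundaries of the cells is a null set. -/

/-- The partial derivative `∂u/∂x_i`. -/
noncomputable def pderiv {F : Type*} [NormedAddCommGroup F] [NormedSpace ℝ F]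
    (i : Fin 3) (u : R3 → F) (x : R3) : F :=
  fderiv ℝ u x (EuclideanSpace.single i 1)

/-- The curl `∇ × u`. -/
noncomputable def curl (u : R3 → R3) (x : R3) : R3 :=
  !₂[pderiv 1 u x 2 - pderiv 2 u x 1,
     pderiv 2 u x 0 - pderiv 0 u x 2,
     pderiv 0 u x 1 - pderiv 1 u x 0]

/-- `⟨u, v⟩_Ω`, the inner product of `L²(Ω)`. -/
noncomputable def ip {F : Type*} [NormedAddCommGroup F] [InnerProductSpace ℝ F]
    (Ω : Set R3) (u v : R3 → F) : ℝ :=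
  ∫ x in Ω, inner ℝ (u x) (v x)

/-- `‖u‖²_Ω`, the squared norm of `L²(Ω)`. -/
noncomputable def normSq {F : Type*} [NormedAddCommGroup F] [InnerProductSpace ℝ F]
    (Ω : Set R3) (u : R3 → F) : ℝ :=
  ip Ω u u

/-- `⟨∇u, ∇v⟩_Ω = ∑ i, ⟨∂_i u, ∂_i v⟩_Ω`. -/
noncomputable def gradIp {F : Type*} [NormedAddCommGroup F] [InnerProductSpace ℝ F]
    (Ω : Set R3) (u v : R3 → F) : ℝ :=
  ∑ i : Fin 3, ip Ω (pderiv i u) (pderiv i v)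

/-- `‖∇u‖²_Ω`. -/
noncomputable def gradNormSq {F : Type*} [NormedAddCommGroup F] [InnerProductSpace ℝ F]
    (Ω : Set R3) (u : R3 → F) : ℝ :=
  gradIp Ω u u

/-! ### Tetrahedral meshes -/

/-- The tetrahedra of a simplicial complex, each given by its set of four vertices. -/
def cells (T : Geometry.SimplicialComplex ℝ R3) : Set (Finset R3) :=
  {s | s ∈ T.faces ∧ s.card = 4}

/-- `T` is a (conforming) tetrahedrization of the polyhedral open set `Ω`: a finite simplicial
complex all of whose vertices, edges and triangles are faces of tetrahedra of the complex, and whose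
underlying set has interior `Ω`. -/
structure IsTetrahedrization (T : Geometry.SimplicialComplex ℝ R3) (Ω : Set R3) : Prop where
  finite : T.faces.Finite
  pure : ∀ s ∈ T.faces, ∃ K ∈ cells T, s ⊆ K
  interior_space : interior T.space = Ω

/-- The restriction of a mesh to `D`: all faces contained in `closure D`. -/
def restrict (T : Geometry.SimplicialComplex ℝ R3) (D : Set R3) :
    Geometry.SimplicialComplex ℝ R3 where
  faces := {s | s ∈ T.faces ∧ convexHull ℝ (s : Set R3) ⊆ closure D}
  isRelLowerSet_faces := by
    rintro s ⟨hs, hsD⟩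
    refine ⟨(T.isRelLowerSet_faces hs).1, fun t hts ht => ⟨T.down_closed hs hts ht, ?_⟩⟩
    exact (convexHull_mono (by exact_mod_cast hts)).trans hsD
  indep := fun hs => T.indep hs.1
  inter_subset_convexHull := fun hs ht => T.inter_subset_convexHull hs.1 ht.1

/-- `h` is the maximal mesh-size, i.e. the largest diameter of a tetrahedron. -/
def IsMeshSize (T : Geometry.SimplicialComplex ℝ R3) (h : ℝ) : Prop :=
  IsGreatest {d | ∃ K ∈ cells T, d = Metric.diam (convexHull ℝ (K : Set R3))} h

/-- Regularity of a mesh of maximal mesh-size `h`, with regularity constant `κ`: each tetrahedron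
contains a ball of radius `κ h`. -/
def IsRegularMesh (κ h : ℝ) (T : Geometry.SimplicialComplex ℝ R3) : Prop :=
  ∀ K ∈ cells T, ∃ c : R3, Metric.ball c (κ * h) ⊆ convexHull ℝ (K : Set R3)

/-! ### Continuous piecewise linear elements -/

/-- `u` is continuous and piecewise linear on the mesh `T`. For vector-valued functions on the
restricted mesh this is the space `𝕍_h`. Values off `T.space` are irrelevant. -/
structure IsP1 {F : Type*} [NormedAddCommGroup F] [NormedSpace ℝ F]
    (T : Geometry.SimplicialComplex ℝ R3) (u : R3 → F) : Prop where
  continuousOn : ContinuousOn u T.space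
  affine : ∀ K ∈ cells T, ∃ A : R3 →ᵃ[ℝ] F, Set.EqOn u A (convexHull ℝ (K : Set R3))

/-- `u` is the element of `𝕍_h` with nodal values `g`, i.e. `u = ∑ n, g(x_n) φ_n`. -/
structure IsNodalInterpolant (T : Geometry.SimplicialComplex ℝ R3) (g u : R3 → R3) : Prop where
  isP1 : IsP1 T u
  nodal : ∀ p ∈ T.vertices, u p = g p

/-- `φ` is the nodal basis ("hat") function of the vertex `p`. -/
structure IsHat (T : Geometry.SimplicialComplex ℝ R3) (p : R3) (φ : R3 → ℝ) : Prop where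
  isP1 : IsP1 T φ
  self : φ p = 1
  other : ∀ q ∈ T.vertices, q ≠ p → φ q = 0

/-- `∫_D ∇φ_i · ∇φ_j ≤ 0` for the basis functions of any two different vertices of the mesh. -/
def HasNonposStiffness (T : Geometry.SimplicialComplex ℝ R3) (D : Set R3) : Prop :=
  ∀ p ∈ T.vertices, ∀ q ∈ T.vertices, p ≠ q →
    ∀ φ ψ : R3 → ℝ, IsHat T p φ → IsHat T q ψ → gradIp D φ ψ ≤ 0

/-- The space `𝕎_h` of those `w ∈ 𝕍_h` that are orthogonal to `m` at each vertex. -/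
structure IsTangent (T : Geometry.SimplicialComplex ℝ R3) (m w : R3 → R3) : Prop where
  isP1 : IsP1 T w
  orth : ∀ p ∈ T.vertices, inner ℝ (w p) (m p) = 0

/-! ### Lowest order edge elements of Nédélec's first family -/

/-- The integral `∫_e u · τ ds` over the segment `e` from `p` to `q`, with unit tangent `τ`
pointing from `p` to `q`. -/
noncomputable def edgeIntegral (u : R3 → R3) (p q : R3) : ℝ :=
  ∫ t in (0 : ℝ)..1, inner ℝ (u (p + t • (q - p))) (q - p)

/-- `ψ` has the form `a_K + b_K × x` inside each tetrahedron `K`, and the integral of its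
tangential component over each edge from `p` to `q` is `c p q`, whichever of the tetrahedra at that
edge is used to compute it. -/
def HasEdgeIntegrals (T : Geometry.SimplicialComplex ℝ R3) (c : R3 → R3 → ℝ)
    (ψ : R3 → R3) : Prop :=
  ∀ K ∈ cells T, ∃ a b : R3,
    (∀ x ∈ interior (convexHull ℝ (K : Set R3)), ψ x = a + cross b x) ∧
    ∀ p ∈ K, ∀ q ∈ K, edgeIntegral (fun x => a + cross b x) p q = c p q

/-- The edge element space `𝕐_h`. -/
def IsEdgeElement (T : Geometry.SimplicialComplex ℝ R3) (ψ : R3 → R3) : Prop :=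
  ∃ c : R3 → R3 → ℝ, HasEdgeIntegrals T c ψ

/-- `ψ ∈ 𝕐_h` is the edge interpolant of `u`. -/
def IsEdgeInterpolant (T : Geometry.SimplicialComplex ℝ R3) (u ψ : R3 → R3) : Prop :=
  HasEdgeIntegrals T (edgeIntegral u) ψ

/-- The tangential component of `u` is integrable along each edge of the mesh, so that the edge
interpolant of `u` makes sense. -/
def HasEdgeTraces (T : Geometry.SimplicialComplex ℝ R3) (u : R3 → R3) : Prop :=
  ∀ K ∈ cells T, ∀ p ∈ K, ∀ q ∈ K,
    IntervalIntegrable (fun t : ℝ => inner ℝ (u (p + t • (q - p))) (q - p)) volume 0 1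

/-! ### The scheme -/

/-- `H^{(j+1/2)}`. -/
noncomputable def half (H : ℕ → R3 → R3) (j : ℕ) : R3 → R3 :=
  fun x => (2 : ℝ)⁻¹ • (H (j + 1) x + H j x)

/-- `dt k H (j + 1)` is `d_t H^{(j+1)} = k⁻¹ (H^{(j+1)} - H^{(j)})`. -/
noncomputable def dt (k : ℝ) (H : ℕ → R3 → R3) (j : ℕ) : R3 → R3 :=
  fun x => k⁻¹ • (H j x - H (j - 1) x)

/-- The sequences `m^{(0)}, …, m^{(J)}`, `v^{(1)}, …, v^{(J)}`, `H^{(0)}, …, H^{(J)}` are produced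
by the `θ`-linear scheme with time step `k` and `J` steps on the mesh `T` of `Dt`, restricted to
`D`, from the initial data `m₀`, `H₀`. -/
structure IsSchemeOutput (Dt D : Set R3) (T : Geometry.SimplicialComplex ℝ R3)
    (lam₁ lam₂ μ σ μ₀ θ k : ℝ) (J : ℕ) (m₀ H₀ : R3 → R3) (m v H : ℕ → R3 → R3) : Prop where
  init_m : IsNodalInterpolant (restrict T D) m₀ (m 0)
  init_H : IsEdgeInterpolant T H₀ (H 0)
  mem_v : ∀ j < J, IsTangent (restrict T D) (m j) (v (j + 1))
  mem_H : ∀ j < J, IsEdgeElement T (H (j + 1))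
  llg : ∀ j < J, ∀ w : R3 → R3, IsTangent (restrict T D) (m j) w →
    lam₂ * ip D (v (j + 1)) w - lam₁ * ip D (fun x => cross (m j x) (v (j + 1) x)) w =
      -μ * gradIp D (fun x => m j x + (k * θ) • v (j + 1) x) w + μ * ip D (half H j) w
  maxwell : ∀ j < J, ∀ ζ : R3 → R3, IsEdgeElement T ζ →
    μ₀ * ip Dt (dt k H (j + 1)) ζ + σ * ip Dt (curl (half H j)) (curl ζ) =
      -μ₀ * ip Dt (D.indicator (v (j + 1))) ζ
  update : ∀ j < J, IsNodalInterpolant (restrict T D)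
    (fun x => ‖m j x + k • v (j + 1) x‖⁻¹ • (m j x + k • v (j + 1) x)) (m (j + 1))

/-- The discrete energy
`‖∇m‖²_D + ‖H‖²_Dt + λ₂ μ⁻¹ μ₀⁻¹ σ ‖∇ × H‖²_Dt`. -/
noncomputable def energy (Dt D : Set R3) (lam₂ μ σ μ₀ : ℝ) (m H : R3 → R3) : ℝ :=
  gradNormSq D m + normSq Dt H + lam₂ * μ⁻¹ * μ₀⁻¹ * σ * normSq Dt (curl H)

end MLLG

/-!
Tangency of `v` gives `|m + k v| ≥ 1` at the nodes, so normalizing the nodal values is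
`1`-Lipschitz there; since the stiffness matrix has nonpositive off-diagonal entries and zero row
sums, this does not increase the Dirichlet energy. Expand `‖∇(m + k v)‖²` and test the
Landau-Lifshitz-Gilbert equation with `v`: its cross product term vanishes. Test Maxwell's equation
with `H^{(j+1/2)}` to cancel the coupling term, and with `d_t H` to trade, by Young's inequality,
half of the dissipation of `v` for that of `d_t H`. The only error term left is
`(1 - 2θ) k² ‖∇v‖²`, which is controlled by an inverse estimate when `θ < 1/2`. The inverse estimate
integrates `A v = u (x + v) - u x`, where `A` is the linear part of `u` on a tetrahedron and `|v|`
is proportional to `h`, over `x` in a ball inside the tetrahedron.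
-/

namespace MLLG

open MeasureTheory Geometry

/-! ### Geometry of tetrahedral meshes -/

/-- The open tetrahedron with vertex set `K`. -/
def cellInterior (K : Finset R3) : Set R3 := interior (convexHull ℝ (K : Set R3))

theorem isOpen_cellInterior (K : Finset R3) : IsOpen (cellInterior K) := isOpen_interior

theorem cellInterior_subset (K : Finset R3) : cellInterior K ⊆ convexHull ℝ (K : Set R3) :=
  interior_subset

theorem isCompact_convexHull_finset (K : Finset R3) : IsCompact (convexHull ℝ (K : Set R3)) :=
  K.finite_toSet.isCompact_convexHull ℝ

theorem cellInterior_ae_eq (K : Finset R3) :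
    cellInterior K =ᵐ[volume] convexHull ℝ (K : Set R3) :=
  interior_ae_eq_of_null_frontier ((convex_convexHull ℝ _).addHaar_frontier volume)

theorem addHaar_convexHull_of_ssubset {E : Type*} [NormedAddCommGroup E] [NormedSpace ℝ E]
    [MeasurableSpace E] [BorelSpace E] [FiniteDimensional ℝ E] (ν : Measure E) [ν.IsAddHaarMeasure]
    {K s : Finset E} (hK : AffineIndependent ℝ ((↑) : K → E)) (hs : s ⊂ K) :
    ν (convexHull ℝ (s : Set E)) = 0 := by
  obtain ⟨p, hpK, hps⟩ := Finset.exists_of_ssubset hs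
  have hsub : (s : Set E) ⊆ ((↑) : K → E) '' (Set.univ \ {⟨p, hpK⟩}) := fun q hq =>
    ⟨⟨q, hs.subset hq⟩, ⟨trivial, fun h => hps (Subtype.mk.inj h ▸ hq)⟩, rfl⟩
  have hp : p ∉ affineSpan ℝ (s : Set E) := fun h =>
    hK.notMem_affineSpan_sdiff ⟨p, hpK⟩ Set.univ (affineSpan_mono ℝ hsub h)
  exact measure_mono_null (convexHull_subset_affineSpan _)
    (Measure.addHaar_affineSubspace ν _ fun htop => hp (htop ▸ AffineSubspace.mem_top ℝ E p))

section Mesh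

variable {T : SimplicialComplex ℝ R3} {Ω D : Set R3}

theorem disjoint_cellInterior {K L : Finset R3} (hK : K ∈ cells T) (hL : L ∈ cells T)
    (hKL : K ≠ L) : Disjoint (cellInterior K) (cellInterior L) := by
  classical
  have hss : K ∩ L ⊂ K := Finset.ssubset_iff_subset_ne.2 ⟨Finset.inter_subset_left, fun h =>
    hKL (Finset.eq_of_subset_of_card_le (Finset.inter_eq_left.1 h) (by rw [hK.2, hL.2]))⟩
  have hsub : cellInterior K ∩ cellInterior L ⊆ convexHull ℝ ((K ∩ L : Finset R3) : Set R3) := by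
    rw [Finset.coe_inter]
    exact (Set.inter_subset_inter (cellInterior_subset K) (cellInterior_subset L)).trans
      (T.inter_subset_convexHull hK.1 hL.1)
  rw [Set.disjoint_iff_inter_eq_empty]
  exact ((isOpen_cellInterior K).inter (isOpen_cellInterior L)).eq_empty_of_measure_zero
    (measure_mono_null hsub (addHaar_convexHull_of_ssubset volume (T.indep hK.1) hss))

theorem cells_restrict_subset (T : SimplicialComplex ℝ R3) (D : Set R3) :
    cells (restrict T D) ⊆ cells T :=
  fun _ hK => ⟨hK.1.1, hK.2⟩

theorem space_restrict_subset (T : SimplicialComplex ℝ R3) (D : Set R3) :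
    (restrict T D).space ⊆ T.space := by
  intro x hx
  obtain ⟨s, hs, hxs⟩ := SimplicialComplex.mem_space_iff.1 hx
  exact SimplicialComplex.mem_space_iff.2 ⟨s, hs.1, hxs⟩

namespace IsTetrahedrization

theorem finite_cells (hT : IsTetrahedrization T Ω) : (cells T).Finite :=
  hT.finite.subset fun _ h => h.1

theorem isOpen (hT : IsTetrahedrization T Ω) : IsOpen Ω :=
  hT.interior_space ▸ isOpen_interior

theorem subset_of_restrict (hT : IsTetrahedrization T Ω)
    (hTD : IsTetrahedrization (restrict T D) D) : D ⊆ Ω :=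
  hTD.interior_space ▸ hT.interior_space ▸ interior_mono (space_restrict_subset T _)

theorem space_eq (hT : IsTetrahedrization T Ω) :
    T.space = ⋃ K ∈ cells T, convexHull ℝ (K : Set R3) := by
  apply subset_antisymm
  · intro x hx
    obtain ⟨s, hs, hxs⟩ := SimplicialComplex.mem_space_iff.1 hx
    obtain ⟨K, hK, hsK⟩ := hT.pure s hs
    exact Set.mem_biUnion hK (convexHull_mono (by exact_mod_cast hsK) hxs)
  · exact Set.iUnion₂_subset fun K hK => SimplicialComplex.convexHull_subset_space hK.1

theorem exists_cell_of_vertex (hT : IsTetrahedrization T Ω) {p : R3} (hp : p ∈ T.vertices) :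
    ∃ K ∈ cells T, p ∈ K := by
  obtain ⟨K, hK, h⟩ := hT.pure _ hp
  exact ⟨K, hK, h (Finset.mem_singleton_self p)⟩

theorem finite_vertices (hT : IsTetrahedrization T Ω) : T.vertices.Finite := by
  rw [SimplicialComplex.vertices_eq]
  exact hT.finite.biUnion fun s _ => s.finite_toSet

theorem cellInterior_subset_domain (hT : IsTetrahedrization T Ω) {K : Finset R3}
    (hK : K ∈ cells T) : cellInterior K ⊆ Ω := by
  rw [← hT.interior_space]
  exact interior_mono (SimplicialComplex.convexHull_subset_space hK.1)

theorem ae_eq_biUnion (hT : IsTetrahedrization T Ω) :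
    Ω =ᵐ[volume] ⋃ K ∈ hT.finite_cells.toFinset, cellInterior K := by
  have hcells : (⋃ K ∈ hT.finite_cells.toFinset, cellInterior K) ⊆ Ω :=
    Set.iUnion₂_subset fun K hK =>
      hT.cellInterior_subset_domain (hT.finite_cells.mem_toFinset.1 hK)
  have hspace : Ω ⊆ ⋃ K ∈ cells T, convexHull ℝ (K : Set R3) :=
    hT.space_eq ▸ hT.interior_space ▸ interior_subset
  refine Filter.EventuallyLE.antisymm (hspace.eventuallyLE.trans ?_) hcells.eventuallyLE
  simp only [Set.Finite.mem_toFinset]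
  exact (Filter.EventuallyEq.countable_bUnion hT.finite_cells.countable
    fun K _ => (cellInterior_ae_eq K).symm).le

theorem ae_of_forall_cell (hT : IsTetrahedrization T Ω) {P : R3 → Prop}
    (h : ∀ K ∈ cells T, ∀ x ∈ cellInterior K, P x) : ∀ᵐ x ∂volume.restrict Ω, P x := by
  rw [Measure.restrict_congr_set hT.ae_eq_biUnion]
  refine (ae_restrict_iff' ?_).2 (Filter.Eventually.of_forall fun x hx => ?_)
  · exact Finset.measurableSet_biUnion _ fun K _ => (isOpen_cellInterior K).measurableSet
  · obtain ⟨K, hK, hxK⟩ := Set.mem_iUnion₂.1 hx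
    exact h K (hT.finite_cells.mem_toFinset.1 hK) x hxK

theorem integral_eq_sum {F : Type*} [NormedAddCommGroup F] [NormedSpace ℝ F]
    (hT : IsTetrahedrization T Ω) {f : R3 → F} (hf : IntegrableOn f Ω) :
    ∫ x in Ω, f x = ∑ K ∈ hT.finite_cells.toFinset, ∫ x in cellInterior K, f x := by
  rw [Measure.restrict_congr_set hT.ae_eq_biUnion]
  refine integral_biUnion_finset _ (fun K _ => (isOpen_cellInterior K).measurableSet) ?_ ?_
  · intro K hK L hL h
    exact disjoint_cellInterior (hT.finite_cells.mem_toFinset.1 hK)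
      (hT.finite_cells.mem_toFinset.1 hL) h
  · exact fun K hK => hf.mono_set
      (hT.cellInterior_subset_domain (hT.finite_cells.mem_toFinset.1 hK))

theorem integrableOn_of_cellwise {F : Type*} [NormedAddCommGroup F] {u : R3 → F}
    (hT : IsTetrahedrization T Ω)
    (hu : ∀ K ∈ cells T, ∃ g, Continuous g ∧ Set.EqOn u g (cellInterior K)) :
    IntegrableOn u Ω := by
  rw [integrableOn_congr_set_ae hT.ae_eq_biUnion, integrableOn_finset_iUnion]
  intro K hK
  obtain ⟨g, hg, hug⟩ := hu K (hT.finite_cells.mem_toFinset.1 hK)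
  refine IntegrableOn.congr_fun (f := g) ?_ hug.symm (isOpen_cellInterior K).measurableSet
  exact (hg.continuousOn.integrableOn_compact (isCompact_convexHull_finset K)).mono_set
    (cellInterior_subset K)

theorem memLp_of_cellwise {F : Type*} [NormedAddCommGroup F] {u : R3 → F}
    (hT : IsTetrahedrization T Ω)
    (hu : ∀ K ∈ cells T, ∃ g, Continuous g ∧ Set.EqOn u g (cellInterior K)) :
    MemLp u 2 (volume.restrict Ω) := by
  refine (memLp_two_iff_integrable_sq_norm (hT.integrableOn_of_cellwise hu).1).2
    (hT.integrableOn_of_cellwise fun K hK => ?_)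
  obtain ⟨g, hg, hug⟩ := hu K hK
  exact ⟨fun x => ‖g x‖ ^ 2, by fun_prop, fun x hx => by simp only [hug hx]⟩

end IsTetrahedrization

end Mesh

/-! ### The `L²` products -/

section L2

variable {F : Type*} [NormedAddCommGroup F] [InnerProductSpace ℝ F] {Ω D : Set R3}
  {u v w : R3 → F}

theorem integrable_inner_of_memLp {α : Type*} [MeasurableSpace α] {ν : Measure α} {u w : α → F}
    (hu : MemLp u 2 ν) (hw : MemLp w 2 ν) : Integrable (fun x => inner ℝ (u x) (w x)) ν :=
  memLp_one_iff_integrable.1 ((innerSL ℝ).memLp_of_bilin 1 hu hw)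

theorem ip_comm (Ω : Set R3) (u w : R3 → F) : ip Ω u w = ip Ω w u := by
  simp only [ip, real_inner_comm]

theorem ip_congr {u' w' : R3 → F} (hu : u =ᵐ[volume.restrict Ω] u')
    (hw : w =ᵐ[volume.restrict Ω] w') : ip Ω u w = ip Ω u' w' := by
  refine integral_congr_ae ?_
  filter_upwards [hu, hw] with x hux hwx
  rw [hux, hwx]

theorem ip_add_left (hu : MemLp u 2 (volume.restrict Ω)) (hv : MemLp v 2 (volume.restrict Ω))
    (hw : MemLp w 2 (volume.restrict Ω)) : ip Ω (u + v) w = ip Ω u w + ip Ω v w := by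
  simp only [ip, Pi.add_apply, inner_add_left]
  exact integral_add (integrable_inner_of_memLp hu hw) (integrable_inner_of_memLp hv hw)

theorem ip_smul_left (Ω : Set R3) (c : ℝ) (u w : R3 → F) : ip Ω (c • u) w = c * ip Ω u w := by
  simp only [ip, Pi.smul_apply, real_inner_smul_left, integral_const_mul]

theorem normSq_nonneg (Ω : Set R3) (u : R3 → F) : 0 ≤ normSq Ω u :=
  integral_nonneg fun _ => real_inner_self_nonneg

theorem normSq_mono (hD : D ⊆ Ω) (hu : MemLp u 2 (volume.restrict Ω)) :
    normSq D u ≤ normSq Ω u :=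
  integral_mono_measure (Measure.restrict_mono hD le_rfl)
    (.of_forall fun _ => real_inner_self_nonneg) (integrable_inner_of_memLp hu hu)

theorem normSq_add (hu : MemLp u 2 (volume.restrict Ω)) (hw : MemLp w 2 (volume.restrict Ω)) :
    normSq Ω (u + w) = normSq Ω u + 2 * ip Ω u w + normSq Ω w := by
  rw [normSq, ip_add_left hu hw (hu.add hw), ip_comm Ω u, ip_comm Ω w, ip_add_left hu hw hu,
    ip_add_left hu hw hw, ip_comm Ω w u]
  simp only [normSq]
  ring

theorem neg_two_mul_ip_le (hu : MemLp u 2 (volume.restrict Ω))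
    (hw : MemLp w 2 (volume.restrict Ω)) : -(2 * ip Ω u w) ≤ normSq Ω u + normSq Ω w := by
  linarith [normSq_add hu hw, normSq_nonneg Ω (u + w)]

theorem ip_sub_add (hu : MemLp u 2 (volume.restrict Ω)) (hw : MemLp w 2 (volume.restrict Ω)) :
    ip Ω (u - w) (u + w) = normSq Ω u - normSq Ω w := by
  have hw' := hw.const_smul (-1 : ℝ)
  rw [sub_eq_add_neg, ← neg_one_smul ℝ w, ip_add_left hu hw' (hu.add hw), ip_smul_left,
    ip_comm Ω u, ip_comm Ω w, ip_add_left hu hw hu, ip_add_left hu hw hw, ip_comm Ω w u]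
  simp only [normSq]
  ring

theorem ip_indicator_left (hD : MeasurableSet D) (hDΩ : D ⊆ Ω) (u w : R3 → F) :
    ip Ω (D.indicator u) w = ip D u w := by
  have : (fun x => inner ℝ (D.indicator u x) (w x)) = D.indicator fun x => inner ℝ (u x) (w x) := by
    ext x
    by_cases hx : x ∈ D <;> simp [hx]
  rw [ip, this, setIntegral_indicator hD, Set.inter_eq_right.2 hDΩ, ip]

theorem ip_sum_smul_sum_smul {ι : Type*} {s : Finset ι} {f : ι → R3 → ℝ}
    (hf : ∀ p ∈ s, MemLp (f p) 2 (volume.restrict Ω)) (a b : ι → F) :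
    ip Ω (fun x => ∑ p ∈ s, f p x • a p) (fun x => ∑ q ∈ s, f q x • b q) =
      ∑ p ∈ s, ∑ q ∈ s, ip Ω (f p) (f q) * inner ℝ (a p) (b q) := by
  have hint : ∀ p ∈ s, ∀ q ∈ s,
      Integrable (fun x => inner ℝ (f p x) (f q x) * inner ℝ (a p) (b q)) (volume.restrict Ω) :=
    fun p hp q hq => (integrable_inner_of_memLp (hf p hp) (hf q hq)).mul_const _
  have hexp : ∀ x, inner ℝ (∑ p ∈ s, f p x • a p) (∑ q ∈ s, f q x • b q) =
      ∑ p ∈ s, ∑ q ∈ s, inner ℝ (f p x) (f q x) * inner ℝ (a p) (b q) := fun x => by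
    rw [sum_inner]
    refine Finset.sum_congr rfl fun p _ => ?_
    rw [inner_sum]
    refine Finset.sum_congr rfl fun q _ => ?_
    rw [real_inner_smul_left, real_inner_smul_right, Real.inner_apply, mul_assoc]
  simp only [ip, hexp]
  rw [integral_finsetSum _ fun p hp => integrable_finsetSum _ fun q hq => hint p hp q hq]
  refine Finset.sum_congr rfl fun p hp => ?_
  rw [integral_finsetSum _ fun q hq => hint p hp q hq]
  simp only [integral_mul_const]

end L2

/-! ### Functions with square integrable derivatives -/

/-- The finite element substitute for `u ∈ H¹(Ω)`: `u` is classically differentiable almost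
everywhere in `Ω`, with square integrable partial derivatives. Jumps of `u` across null sets are
allowed, so this holds cell by cell for edge elements, too. -/
structure HasL2Deriv {F : Type*} [NormedAddCommGroup F] [NormedSpace ℝ F]
    (Ω : Set R3) (u : R3 → F) : Prop where
  differentiableAt : ∀ᵐ x ∂volume.restrict Ω, DifferentiableAt ℝ u x
  memLp : ∀ i, MemLp (pderiv i u) 2 (volume.restrict Ω)

section pderiv

variable {F : Type*} [NormedAddCommGroup F] [NormedSpace ℝ F] {Ω : Set R3} {u w : R3 → F}

theorem pderiv_smul (i : Fin 3) (c : ℝ) (u : R3 → F) : pderiv i (c • u) = c • pderiv i u := by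
  ext x
  simp only [pderiv, fderiv_const_smul_field, Pi.smul_apply, smul_apply]

theorem pderiv_add {x : R3} (i : Fin 3) (hu : DifferentiableAt ℝ u x)
    (hw : DifferentiableAt ℝ w x) : pderiv i (u + w) x = pderiv i u x + pderiv i w x := by
  rw [pderiv, fderiv_add hu hw, add_apply, pderiv, pderiv]

theorem HasL2Deriv.pderiv_add_ae (i : Fin 3) (hu : HasL2Deriv Ω u) (hw : HasL2Deriv Ω w) :
    pderiv i (u + w) =ᵐ[volume.restrict Ω] pderiv i u + pderiv i w := by
  filter_upwards [hu.differentiableAt, hw.differentiableAt] with x hux hwx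
  exact pderiv_add i hux hwx

theorem HasL2Deriv.add (hu : HasL2Deriv Ω u) (hw : HasL2Deriv Ω w) : HasL2Deriv Ω (u + w) where
  differentiableAt := by
    filter_upwards [hu.differentiableAt, hw.differentiableAt] with x hux hwx
    exact hux.add hwx
  memLp i := ((hu.memLp i).add (hw.memLp i)).ae_eq (hu.pderiv_add_ae i hw).symm

theorem HasL2Deriv.smul (hu : HasL2Deriv Ω u) (c : ℝ) : HasL2Deriv Ω (c • u) where
  differentiableAt := hu.differentiableAt.mono fun _ hx => hx.const_smul c
  memLp i := pderiv_smul i c u ▸ (hu.memLp i).const_smul c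

end pderiv

section grad

variable {F : Type*} [NormedAddCommGroup F] [InnerProductSpace ℝ F] {Ω : Set R3}
  {u v w : R3 → F}

theorem gradIp_comm (Ω : Set R3) (u w : R3 → F) : gradIp Ω u w = gradIp Ω w u :=
  Finset.sum_congr rfl fun _ _ => ip_comm Ω _ _

theorem gradIp_add_left (hu : HasL2Deriv Ω u) (hv : HasL2Deriv Ω v) (hw : HasL2Deriv Ω w) :
    gradIp Ω (u + v) w = gradIp Ω u w + gradIp Ω v w := by
  simp only [gradIp, ← Finset.sum_add_distrib]
  refine Finset.sum_congr rfl fun i _ => ?_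
  rw [ip_congr (hu.pderiv_add_ae i hv) .rfl, ip_add_left (hu.memLp i) (hv.memLp i) (hw.memLp i)]

theorem gradIp_smul_left (Ω : Set R3) (c : ℝ) (u w : R3 → F) :
    gradIp Ω (c • u) w = c * gradIp Ω u w := by
  simp only [gradIp, pderiv_smul, ip_smul_left, Finset.mul_sum]

theorem gradNormSq_nonneg (Ω : Set R3) (u : R3 → F) : 0 ≤ gradNormSq Ω u :=
  Finset.sum_nonneg (s := Finset.univ) fun i _ => normSq_nonneg Ω (pderiv i u)

theorem gradNormSq_add_smul (hu : HasL2Deriv Ω u) (hw : HasL2Deriv Ω w) (c : ℝ) :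
    gradNormSq Ω (u + c • w) =
      gradNormSq Ω u + 2 * c * gradIp Ω u w + c ^ 2 * gradNormSq Ω w := by
  have hcw := hw.smul c
  simp only [gradNormSq]
  rw [gradIp_add_left hu hcw (hu.add hcw), gradIp_smul_left, gradIp_comm Ω u, gradIp_comm Ω w,
    gradIp_add_left hu hcw hu, gradIp_add_left hu hcw hw, gradIp_smul_left, gradIp_smul_left,
    gradIp_comm Ω w u]
  ring

end grad

section curl

variable {Ω : Set R3} {u w : R3 → R3}

/-- The cross product as a bilinear map. -/
noncomputable def crossLM : R3 →ₗ[ℝ] R3 →ₗ[ℝ] R3 :=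
  LinearMap.mk₂ ℝ cross
    (fun a b v => by simp only [cross, WithLp.ofLp_add, LinearMap.map_add₂, WithLp.toLp_add])
    (fun c a v => by simp only [cross, WithLp.ofLp_smul, LinearMap.map_smul₂, WithLp.toLp_smul])
    (fun a v w => by simp only [cross, WithLp.ofLp_add, map_add, WithLp.toLp_add])
    (fun c a v => by simp only [cross, WithLp.ofLp_smul, map_smul, WithLp.toLp_smul])

theorem crossLM_apply (a v : R3) : crossLM a v = cross a v := rfl

theorem curl_eq_sum_cross (u : R3 → R3) :
    curl u = ∑ i, crossLM (EuclideanSpace.single i 1) ∘ pderiv i u := by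
  ext x i
  fin_cases i <;>
    simp [curl, Fin.sum_univ_three, crossLM_apply, cross, crossProduct, sub_eq_add_neg, add_comm]

theorem curl_smul (c : ℝ) (u : R3 → R3) : curl (c • u) = c • curl u := by
  ext x
  simp [curl_eq_sum_cross, pderiv_smul, Finset.smul_sum]

theorem HasL2Deriv.memLp_curl (hu : HasL2Deriv Ω u) : MemLp (curl u) 2 (volume.restrict Ω) := by
  rw [curl_eq_sum_cross]
  exact memLp_finsetSum' _ fun i _ => (crossLM _).toContinuousLinearMap.comp_memLp' (hu.memLp i)

theorem HasL2Deriv.curl_add_ae (hu : HasL2Deriv Ω u) (hw : HasL2Deriv Ω w) :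
    curl (u + w) =ᵐ[volume.restrict Ω] curl u + curl w := by
  filter_upwards [hu.differentiableAt, hw.differentiableAt] with x hux hwx
  simp [curl_eq_sum_cross, pderiv_add _ hux hwx, Finset.sum_add_distrib]

theorem HasL2Deriv.curl_sub_ae (hu : HasL2Deriv Ω u) (hw : HasL2Deriv Ω w) :
    curl (u - w) =ᵐ[volume.restrict Ω] curl u - curl w := by
  have h := hu.curl_add_ae (hw.smul (-1))
  rw [curl_smul] at h
  simpa only [neg_one_smul, ← sub_eq_add_neg] using h

end curl

/-! ### Finite element spaces -/

section FiniteElements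

variable {F : Type*} [NormedAddCommGroup F] [NormedSpace ℝ F] {T : SimplicialComplex ℝ R3}
  {Ω : Set R3} {u w : R3 → F}

/-- The functions that agree with an affine map inside each cell of `T`. Both the piecewise linear
functions and the edge elements are of this form. -/
def cellwiseAffine (T : SimplicialComplex ℝ R3) (F : Type*) [NormedAddCommGroup F]
    [NormedSpace ℝ F] : Submodule ℝ (R3 → F) where
  carrier := {u | ∀ K ∈ cells T, ∃ A : R3 →ᵃ[ℝ] F, Set.EqOn u A (cellInterior K)}
  zero_mem' _ _ := ⟨0, fun _ _ => rfl⟩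
  add_mem' hu hw K hK := by
    obtain ⟨A, hA⟩ := hu K hK
    obtain ⟨B, hB⟩ := hw K hK
    exact ⟨A + B, fun x hx => congrArg₂ (· + ·) (hA hx) (hB hx)⟩
  smul_mem' c u hu K hK := by
    obtain ⟨A, hA⟩ := hu K hK
    exact ⟨c • A, fun x hx => congrArg (c • ·) (hA hx)⟩

theorem hasFDerivAt_affineMap {E : Type*} [NormedAddCommGroup E] [NormedSpace ℝ E]
    [FiniteDimensional ℝ E] (A : E →ᵃ[ℝ] F) (x : E) :
    HasFDerivAt A A.linear.toContinuousLinearMap x := by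
  rw [A.decomp]
  exact A.linear.toContinuousLinearMap.hasFDerivAt.add_const (A 0)

theorem hasFDerivAt_of_eqOn_cellInterior {K : Finset R3} {A : R3 →ᵃ[ℝ] F}
    (hA : Set.EqOn u A (cellInterior K)) {x : R3} (hx : x ∈ cellInterior K) :
    HasFDerivAt u A.linear.toContinuousLinearMap x :=
  (hasFDerivAt_affineMap A x).congr_of_eventuallyEq
    (hA.eventuallyEq_of_mem ((isOpen_cellInterior K).mem_nhds hx))

theorem pderiv_of_eqOn_cellInterior {K : Finset R3} {A : R3 →ᵃ[ℝ] F}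
    (hA : Set.EqOn u A (cellInterior K)) (i : Fin 3) {x : R3} (hx : x ∈ cellInterior K) :
    pderiv i u x = A.linear (EuclideanSpace.single i 1) := by
  rw [pderiv, (hasFDerivAt_of_eqOn_cellInterior hA hx).fderiv]
  rfl

theorem memLp_of_mem_cellwiseAffine (hT : IsTetrahedrization T Ω)
    (hu : u ∈ cellwiseAffine T F) : MemLp u 2 (volume.restrict Ω) :=
  hT.memLp_of_cellwise fun K hK =>
    let ⟨A, hA⟩ := hu K hK
    ⟨A, A.continuous_of_finiteDimensional, hA⟩

theorem hasL2Deriv_of_mem_cellwiseAffine (hT : IsTetrahedrization T Ω)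
    (hu : u ∈ cellwiseAffine T F) : HasL2Deriv Ω u where
  differentiableAt := hT.ae_of_forall_cell fun K hK _ hx =>
    let ⟨_, hA⟩ := hu K hK
    (hasFDerivAt_of_eqOn_cellInterior hA hx).differentiableAt
  memLp i := hT.memLp_of_cellwise fun K hK =>
    let ⟨_, hA⟩ := hu K hK
    ⟨_, continuous_const, fun _ hx => pderiv_of_eqOn_cellInterior hA i hx⟩

/-- The continuous piecewise linear functions on `T` as a vector space. -/
def p1Space (T : SimplicialComplex ℝ R3) (F : Type*) [NormedAddCommGroup F]
    [NormedSpace ℝ F] : Submodule ℝ (R3 → F) where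
  carrier := {u | IsP1 T u}
  zero_mem' := ⟨continuousOn_const, fun _ _ => ⟨0, fun _ _ => rfl⟩⟩
  add_mem' hu hw := by
    refine ⟨hu.continuousOn.add hw.continuousOn, fun K hK => ?_⟩
    obtain ⟨A, hA⟩ := hu.affine K hK
    obtain ⟨B, hB⟩ := hw.affine K hK
    exact ⟨A + B, fun x hx => congrArg₂ (· + ·) (hA hx) (hB hx)⟩
  smul_mem' c u hu := by
    refine ⟨hu.continuousOn.const_smul c, fun K hK => ?_⟩
    obtain ⟨A, hA⟩ := hu.affine K hK
    exact ⟨c • A, fun x hx => congrArg (c • ·) (hA hx)⟩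

theorem IsP1.mem_cellwiseAffine (hu : IsP1 T u) : u ∈ cellwiseAffine T F := fun K hK =>
  let ⟨A, hA⟩ := hu.affine K hK
  ⟨A, hA.mono (cellInterior_subset K)⟩

theorem IsP1.memLp (hT : IsTetrahedrization T Ω) (hu : IsP1 T u) :
    MemLp u 2 (volume.restrict Ω) :=
  memLp_of_mem_cellwiseAffine hT hu.mem_cellwiseAffine

theorem IsP1.hasL2Deriv (hT : IsTetrahedrization T Ω) (hu : IsP1 T u) : HasL2Deriv Ω u :=
  hasL2Deriv_of_mem_cellwiseAffine hT hu.mem_cellwiseAffine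

end FiniteElements

section EdgeElements

variable {T : SimplicialComplex ℝ R3} {Ω : Set R3}

/-- The affine map `x ↦ a + b × x`, the local form of an edge element. -/
noncomputable def edgeAffine (a b : R3) : R3 →ᵃ[ℝ] R3 :=
  AffineMap.const ℝ R3 a + (crossLM b).toAffineMap

theorem edgeAffine_add (a b a' b' : R3) :
    edgeAffine (a + a') (b + b') = edgeAffine a b + edgeAffine a' b' := by
  ext1 x
  simp only [edgeAffine, AffineMap.coe_add, Pi.add_apply, AffineMap.coe_const, Function.const_apply,
    LinearMap.coe_toAffineMap, map_add, LinearMap.add_apply]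
  exact add_add_add_comm _ _ _ _

theorem edgeAffine_smul (c : ℝ) (a b : R3) :
    edgeAffine (c • a) (c • b) = c • edgeAffine a b := by
  ext1 x
  simp [edgeAffine]

theorem edgeIntegral_add {f g : R3 → R3} (hf : Continuous f) (hg : Continuous g) (p q : R3) :
    edgeIntegral (f + g) p q = edgeIntegral f p q + edgeIntegral g p q := by
  simp only [edgeIntegral, Pi.add_apply, inner_add_left]
  exact intervalIntegral.integral_add (Continuous.intervalIntegrable (by fun_prop) _ _)
    (Continuous.intervalIntegrable (by fun_prop) _ _)

theorem edgeIntegral_smul (c : ℝ) (f : R3 → R3) (p q : R3) :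
    edgeIntegral (c • f) p q = c * edgeIntegral f p q := by
  simp only [edgeIntegral, Pi.smul_apply, real_inner_smul_left,
    intervalIntegral.integral_const_mul]

theorem hasEdgeIntegrals_iff {c : R3 → R3 → ℝ} {ψ : R3 → R3} :
    HasEdgeIntegrals T c ψ ↔ ∀ K ∈ cells T, ∃ a b : R3,
      Set.EqOn ψ (edgeAffine a b) (cellInterior K) ∧
        ∀ p ∈ K, ∀ q ∈ K, edgeIntegral (edgeAffine a b) p q = c p q :=
  Iff.rfl

/-- The edge elements on `T` as a vector space. -/
def edgeSpace (T : SimplicialComplex ℝ R3) : Submodule ℝ (R3 → R3) where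
  carrier := {ψ | IsEdgeElement T ψ}
  zero_mem' := ⟨0, fun _ _ => ⟨0, 0, by simp [cross], by simp [cross, edgeIntegral]⟩⟩
  add_mem' := by
    rintro ψ ζ ⟨c, hc⟩ ⟨d, hd⟩
    refine ⟨c + d, hasEdgeIntegrals_iff.2 fun K hK => ?_⟩
    obtain ⟨a, b, hψ, hc⟩ := hasEdgeIntegrals_iff.1 hc K hK
    obtain ⟨a', b', hζ, hd⟩ := hasEdgeIntegrals_iff.1 hd K hK
    refine ⟨a + a', b + b', ?_, fun p hp q hq => ?_⟩ <;> rw [edgeAffine_add, AffineMap.coe_add]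
    · exact fun x hx => congrArg₂ (· + ·) (hψ hx) (hζ hx)
    · rw [edgeIntegral_add (AffineMap.continuous_of_finiteDimensional _)
        (AffineMap.continuous_of_finiteDimensional _), hc p hp q hq, hd p hp q hq]
      rfl
  smul_mem' := by
    rintro r ψ ⟨c, hc⟩
    refine ⟨r • c, hasEdgeIntegrals_iff.2 fun K hK => ?_⟩
    obtain ⟨a, b, hψ, hc⟩ := hasEdgeIntegrals_iff.1 hc K hK
    refine ⟨r • a, r • b, ?_, fun p hp q hq => ?_⟩ <;> rw [edgeAffine_smul, AffineMap.coe_smul]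
    · exact fun x hx => congrArg (r • ·) (hψ hx)
    · rw [edgeIntegral_smul, hc p hp q hq]
      rfl

namespace IsEdgeElement

variable {ψ : R3 → R3}

theorem mem_cellwiseAffine (hψ : IsEdgeElement T ψ) : ψ ∈ cellwiseAffine T R3 := fun K hK =>
  let ⟨_, hc⟩ := hψ
  let ⟨a, b, hab, _⟩ := hasEdgeIntegrals_iff.1 hc K hK
  ⟨edgeAffine a b, hab⟩

theorem memLp (hT : IsTetrahedrization T Ω) (hψ : IsEdgeElement T ψ) :
    MemLp ψ 2 (volume.restrict Ω) :=
  memLp_of_mem_cellwiseAffine hT hψ.mem_cellwiseAffine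

theorem hasL2Deriv (hT : IsTetrahedrization T Ω) (hψ : IsEdgeElement T ψ) : HasL2Deriv Ω ψ :=
  hasL2Deriv_of_mem_cellwiseAffine hT hψ.mem_cellwiseAffine

end IsEdgeElement

end EdgeElements

/-! ### Nodal interpolation -/

section Nodal

variable {F : Type*} [NormedAddCommGroup F] [NormedSpace ℝ F] {T : SimplicialComplex ℝ R3}
  {Ω : Set R3}

theorem mem_vertices_of_mem_cell {K : Finset R3} (hK : K ∈ cells T) {p : R3} (hp : p ∈ K) :
    p ∈ T.vertices :=
  T.down_closed hK.1 (Finset.singleton_subset_iff.2 hp) (Finset.singleton_nonempty p)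

theorem eqOn_convexHull_of_eqOn {E : Type*} [AddCommGroup E] [Module ℝ E] {A B : E →ᵃ[ℝ] F}
    {s : Set E} (h : Set.EqOn A B s) : Set.EqOn A B (convexHull ℝ s) :=
  (AffineMap.eqOn_affineSpan h).mono (convexHull_subset_affineSpan s)

theorem exists_affineMap_eqOn_cell {K : Finset R3} (hK : K ∈ cells T) (g : R3 → F) :
    ∃ A : R3 →ᵃ[ℝ] F, Set.EqOn A g K := by
  have hind := T.indep hK.1
  have htop : affineSpan ℝ (Set.range ((↑) : K → R3)) = ⊤ := by
    rw [hind.affineSpan_eq_top_iff_card_eq_finrank_add_one]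
    simp [hK.2]
  let b : AffineBasis K ℝ R3 := ⟨(↑), hind, htop⟩
  refine ⟨(Fintype.linearCombination ℝ fun q : K => g q).toAffineMap.comp b.coords,
    fun q hq => ?_⟩
  have hcoords : b.coords q = Pi.single ⟨q, hq⟩ 1 := by
    ext r
    rw [b.coords_apply, Pi.single_apply]
    exact b.coord_apply r ⟨q, hq⟩
  rw [AffineMap.comp_apply, hcoords, LinearMap.coe_toAffineMap,
    Fintype.linearCombination_apply_single, one_smul]

theorem IsP1.eqOn_convexHull {u w : R3 → F} (hu : IsP1 T u) (hw : IsP1 T w) {K : Finset R3}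
    (hK : K ∈ cells T) (h : Set.EqOn u w K) : Set.EqOn u w (convexHull ℝ (K : Set R3)) := by
  obtain ⟨A, hA⟩ := hu.affine K hK
  obtain ⟨B, hB⟩ := hw.affine K hK
  have hsub := subset_convexHull ℝ (K : Set R3)
  have hAB : Set.EqOn A B K := (hA.mono hsub).symm.trans (h.trans (hB.mono hsub))
  exact hA.trans ((eqOn_convexHull_of_eqOn hAB).trans hB.symm)

theorem exists_isP1 (hT : IsTetrahedrization T Ω) (g : R3 → F) :
    ∃ u : R3 → F, IsP1 T u ∧ Set.EqOn u g T.vertices := by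
  choose! A hA using fun K hK => exists_affineMap_eqOn_cell (T := T) (K := K) hK g
  have hcompat : ∀ K ∈ cells T, ∀ L ∈ cells T, Set.EqOn (A K) (A L)
      (convexHull ℝ (K : Set R3) ∩ convexHull ℝ (L : Set R3)) := fun K hK L hL =>
    (eqOn_convexHull_of_eqOn fun q hq => (hA K hK hq.1).trans (hA L hL hq.2).symm).mono
      (T.inter_subset_convexHull hK.1 hL.1)
  let cell : R3 → Finset R3 := fun x =>
    Classical.epsilon fun K => K ∈ cells T ∧ x ∈ convexHull ℝ (K : Set R3)
  have hu : ∀ K ∈ cells T, Set.EqOn (fun x => A (cell x) x) (A K) (convexHull ℝ (K : Set R3)) :=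
    fun K hK x hx =>
      have hcell := Classical.epsilon_spec
        (p := fun K => K ∈ cells T ∧ x ∈ convexHull ℝ (K : Set R3)) ⟨K, hK, hx⟩
      hcompat _ hcell.1 K hK ⟨hcell.2, hx⟩
  refine ⟨fun x => A (cell x) x, ⟨?_, fun K hK => ⟨A K, hu K hK⟩⟩, fun p hp => ?_⟩
  · rw [hT.space_eq, Set.biUnion_eq_iUnion]
    have := hT.finite_cells.to_subtype
    exact (locallyFinite_of_finite _).continuousOn_iUnion
      (fun K => (isCompact_convexHull_finset K).isClosed)
      fun K => (A K).continuous_of_finiteDimensional.continuousOn.congr (hu K K.2)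
  · obtain ⟨K, hK, hpK⟩ := hT.exists_cell_of_vertex hp
    exact (hu K hK (subset_convexHull ℝ _ hpK)).trans (hA K hK hpK)

/-- `φ p`, for `p` in `V`, is the nodal basis of the continuous piecewise linear functions on `T`,
and `V` is the set of vertices of `T` as a `Finset`. -/
structure IsNodalBasis (T : SimplicialComplex ℝ R3) (V : Finset R3) (φ : R3 → R3 → ℝ) : Prop where
  coe_eq : (V : Set R3) = T.vertices
  isHat : ∀ p ∈ V, IsHat T p (φ p)

theorem exists_isNodalBasis (hT : IsTetrahedrization T Ω) :
    ∃ (V : Finset R3) (φ : R3 → R3 → ℝ), IsNodalBasis T V φ := by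
  classical
  choose φ hφ using fun p => exists_isP1 hT fun q => if q = p then (1 : ℝ) else 0
  refine ⟨hT.finite_vertices.toFinset, φ, hT.finite_vertices.coe_toFinset, fun p hp => ?_⟩
  have hp' := hT.finite_vertices.mem_toFinset.1 hp
  exact ⟨(hφ p).1, ((hφ p).2 hp').trans (if_pos rfl),
    fun q hq hqp => ((hφ p).2 hq).trans (if_neg hqp)⟩

theorem IsP1.smul_const {f : R3 → ℝ} (hf : IsP1 T f) (a : F) : IsP1 T fun x => f x • a where
  continuousOn := hf.continuousOn.smul continuousOn_const
  affine K hK := by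
    obtain ⟨A, hA⟩ := hf.affine K hK
    exact ⟨(LinearMap.toSpanSingleton ℝ F a).toAffineMap.comp A, fun x hx => by simp [hA hx]⟩

namespace IsNodalBasis

variable {V : Finset R3} {φ : R3 → R3 → ℝ}

theorem mem_iff (hφ : IsNodalBasis T V φ) {p : R3} : p ∈ V ↔ p ∈ T.vertices := by
  rw [← hφ.coe_eq, Finset.mem_coe]

theorem eqOn_sum (hφ : IsNodalBasis T V φ) {u : R3 → F} (hu : IsP1 T u) {K : Finset R3}
    (hK : K ∈ cells T) :
    Set.EqOn u (fun x => ∑ p ∈ V, φ p x • u p) (convexHull ℝ (K : Set R3)) := by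
  have hsum : (∑ p ∈ V, fun x => φ p x • u p) ∈ p1Space T F :=
    Submodule.sum_mem _ fun p hp => (hφ.isHat p hp).isP1.smul_const (u p)
  rw [Finset.sum_fn] at hsum
  refine hu.eqOn_convexHull hsum hK fun q hq => ?_
  have hqT := mem_vertices_of_mem_cell hK hq
  have hqV := hφ.mem_iff.2 hqT
  have hne : ∀ p ∈ V, p ≠ q → φ p q • u p = 0 := fun p hp hpq => by
    rw [(hφ.isHat p hp).other q hqT hpq.symm, zero_smul]
  simp only [Finset.sum_eq_single_of_mem q hqV hne, (hφ.isHat q hqV).self, one_smul]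

theorem pderiv_ae_eq_sum (hφ : IsNodalBasis T V φ) (hT : IsTetrahedrization T Ω) {u : R3 → F}
    (hu : IsP1 T u) (i : Fin 3) :
    pderiv i u =ᵐ[volume.restrict Ω] fun x => ∑ p ∈ V, pderiv i (φ p) x • u p := by
  refine hT.ae_of_forall_cell fun K hK x hx => ?_
  have hdiff : ∀ p ∈ V, DifferentiableAt ℝ (φ p) x := fun p hp =>
    have ⟨_, hA⟩ := (hφ.isHat p hp).isP1.mem_cellwiseAffine K hK
    (hasFDerivAt_of_eqOn_cellInterior hA hx).differentiableAt
  have heq : u =ᶠ[nhds x] fun x => ∑ p ∈ V, φ p x • u p :=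
    ((hφ.eqOn_sum hu hK).mono (cellInterior_subset K)).eventuallyEq_of_mem
      ((isOpen_cellInterior K).mem_nhds hx)
  rw [pderiv, heq.fderiv_eq, fderiv_fun_sum fun p hp => (hdiff p hp).smul_const (u p),
    sum_apply]
  refine Finset.sum_congr rfl fun p hp => ?_
  rw [fderiv_smul_const (hdiff p hp), ContinuousLinearMap.smulRight_apply, pderiv]

end IsNodalBasis

end Nodal

/-! ### The stiffness matrix and nodal normalization -/

section Stiffness

variable {F : Type*} [NormedAddCommGroup F] [InnerProductSpace ℝ F] {T : SimplicialComplex ℝ R3}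
  {Ω : Set R3} {V : Finset R3} {φ : R3 → R3 → ℝ}

theorem IsNodalBasis.gradIp_eq_sum (hφ : IsNodalBasis T V φ) (hT : IsTetrahedrization T Ω)
    {u w : R3 → F} (hu : IsP1 T u) (hw : IsP1 T w) :
    gradIp Ω u w = ∑ p ∈ V, ∑ q ∈ V, gradIp Ω (φ p) (φ q) * inner ℝ (u p) (w q) := by
  have hi : ∀ i, ip Ω (pderiv i u) (pderiv i w) =
      ∑ p ∈ V, ∑ q ∈ V, ip Ω (pderiv i (φ p)) (pderiv i (φ q)) * inner ℝ (u p) (w q) := fun i => by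
    rw [ip_congr (hφ.pderiv_ae_eq_sum hT hu i) (hφ.pderiv_ae_eq_sum hT hw i),
      ip_sum_smul_sum_smul fun p hp => ((hφ.isHat p hp).isP1.hasL2Deriv hT).memLp i]
  simp only [gradIp, hi, Finset.sum_mul]
  rw [Finset.sum_comm]
  exact Finset.sum_congr rfl fun p _ => Finset.sum_comm

theorem IsNodalBasis.sum_gradIp_eq_zero (hφ : IsNodalBasis T V φ) (hT : IsTetrahedrization T Ω)
    {p : R3} (hp : p ∈ V) : ∑ q ∈ V, gradIp Ω (φ p) (φ q) = 0 := by
  have hone : IsP1 T fun _ => (1 : ℝ) :=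
    ⟨continuousOn_const, fun _ _ => ⟨AffineMap.const ℝ R3 1, fun _ _ => rfl⟩⟩
  have hφp := hφ.isHat p hp
  have hne : ∀ r ∈ V, r ≠ p → ∑ q ∈ V, gradIp Ω (φ r) (φ q) * inner ℝ (φ p r) (1 : ℝ) = 0 :=
    fun r hr hrp => by simp [hφp.other r (hφ.mem_iff.1 hr) hrp]
  calc ∑ q ∈ V, gradIp Ω (φ p) (φ q) = gradIp Ω (φ p) fun _ => (1 : ℝ) := by
        rw [hφ.gradIp_eq_sum hT hφp.isP1 hone, Finset.sum_eq_single_of_mem p hp hne]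
        simp [hφp.self]
    _ = 0 := by simp [gradIp, ip, pderiv]

theorem sum_mul_inner_eq_of_sum_eq_zero {ι : Type*} {V : Finset ι} {a : ι → ι → ℝ}
    (hrow : ∀ p ∈ V, ∑ q ∈ V, a p q = 0) (hcol : ∀ q ∈ V, ∑ p ∈ V, a p q = 0) (u : ι → F) :
    ∑ p ∈ V, ∑ q ∈ V, a p q * inner ℝ (u p) (u q) =
      -(2⁻¹ * ∑ p ∈ V, ∑ q ∈ V, a p q * ‖u p - u q‖ ^ 2) := by
  have hp : ∑ p ∈ V, ∑ q ∈ V, a p q * ‖u p‖ ^ 2 = 0 :=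
    Finset.sum_eq_zero fun p hp => by rw [← Finset.sum_mul, hrow p hp, zero_mul]
  have hq : ∑ p ∈ V, ∑ q ∈ V, a p q * ‖u q‖ ^ 2 = 0 := by
    rw [Finset.sum_comm]
    exact Finset.sum_eq_zero fun q hq => by rw [← Finset.sum_mul, hcol q hq, zero_mul]
  have hexp : ∑ p ∈ V, ∑ q ∈ V, a p q * ‖u p - u q‖ ^ 2 =
      ∑ p ∈ V, ∑ q ∈ V, a p q * ‖u p‖ ^ 2 - 2 * ∑ p ∈ V, ∑ q ∈ V, a p q * inner ℝ (u p) (u q)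
        + ∑ p ∈ V, ∑ q ∈ V, a p q * ‖u q‖ ^ 2 := by
    simp only [Finset.mul_sum, ← Finset.sum_sub_distrib, ← Finset.sum_add_distrib]
    refine Finset.sum_congr rfl fun p _ => Finset.sum_congr rfl fun q _ => ?_
    rw [norm_sub_sq_real]
    ring
  rw [hexp, hp, hq]
  ring

theorem IsNodalBasis.gradNormSq_eq_sum (hφ : IsNodalBasis T V φ) (hT : IsTetrahedrization T Ω)
    {u : R3 → F} (hu : IsP1 T u) :
    gradNormSq Ω u =
      -(2⁻¹ * ∑ p ∈ V, ∑ q ∈ V, gradIp Ω (φ p) (φ q) * ‖u p - u q‖ ^ 2) := by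
  have hrow := fun p (hp : p ∈ V) => hφ.sum_gradIp_eq_zero hT hp
  have hcol : ∀ q ∈ V, ∑ p ∈ V, gradIp Ω (φ p) (φ q) = 0 := by
    simpa only [gradIp_comm Ω] using hrow
  rw [gradNormSq, hφ.gradIp_eq_sum hT hu hu, sum_mul_inner_eq_of_sum_eq_zero hrow hcol]

theorem gradNormSq_le_of_nodal (hT : IsTetrahedrization T Ω) (hst : HasNonposStiffness T Ω)
    {u w : R3 → F} (hu : IsP1 T u) (hw : IsP1 T w)
    (hle : ∀ p ∈ T.vertices, ∀ q ∈ T.vertices, ‖w p - w q‖ ≤ ‖u p - u q‖) :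
    gradNormSq Ω w ≤ gradNormSq Ω u := by
  obtain ⟨V, φ, hφ⟩ := exists_isNodalBasis hT
  rw [hφ.gradNormSq_eq_sum hT hu, hφ.gradNormSq_eq_sum hT hw]
  gcongr -(2⁻¹ * ?_)
  refine Finset.sum_le_sum fun p hp => Finset.sum_le_sum fun q hq => ?_
  have hpT := hφ.mem_iff.1 hp
  have hqT := hφ.mem_iff.1 hq
  rcases eq_or_ne p q with rfl | hpq
  · simp only [sub_self, le_refl]
  · exact mul_le_mul_of_nonpos_left (pow_le_pow_left₀ (norm_nonneg _) (hle p hpT q hqT) 2)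
      (hst p hpT q hqT hpq _ _ (hφ.isHat p hp) (hφ.isHat q hq))

theorem norm_normalize_sub_le {x y : F} (hx : 1 ≤ ‖x‖) (hy : 1 ≤ ‖y‖) :
    ‖‖x‖⁻¹ • x - ‖y‖⁻¹ • y‖ ≤ ‖x - y‖ := by
  have hx0 : ‖x‖ ≠ 0 := by positivity
  have hy0 : ‖y‖ ≠ 0 := by positivity
  have hexp : ‖x‖ * ‖y‖ * ‖‖x‖⁻¹ • x - ‖y‖⁻¹ • y‖ ^ 2 = ‖x - y‖ ^ 2 - (‖x‖ - ‖y‖) ^ 2 := by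
    rw [norm_sub_sq_real, norm_sub_sq_real, real_inner_smul_left, real_inner_smul_right, norm_smul,
      norm_smul, norm_inv, norm_inv, norm_norm, norm_norm, inv_mul_cancel₀ hx0,
      inv_mul_cancel₀ hy0]
    field_simp
    ring
  refine le_of_sq_le_sq ?_ (norm_nonneg _)
  calc ‖‖x‖⁻¹ • x - ‖y‖⁻¹ • y‖ ^ 2
      ≤ ‖x‖ * ‖y‖ * ‖‖x‖⁻¹ • x - ‖y‖⁻¹ • y‖ ^ 2 :=
        le_mul_of_one_le_left (sq_nonneg _) (one_le_mul_of_one_le_of_one_le hx hy)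
    _ = ‖x - y‖ ^ 2 - (‖x‖ - ‖y‖) ^ 2 := hexp
    _ ≤ ‖x - y‖ ^ 2 := sub_le_self _ (sq_nonneg _)

end Stiffness

/-! ### The inverse estimate -/

section InverseEstimate

theorem sq_norm_linear_le {E F : Type*} [AddCommGroup E] [Module ℝ E] [NormedAddCommGroup F]
    [NormedSpace ℝ F] (A : E →ᵃ[ℝ] F) (x v : E) :
    ‖A.linear v‖ ^ 2 ≤ 2 * (‖A (x + v)‖ ^ 2 + ‖A x‖ ^ 2) := by
  have hv : A.linear v = A (x + v) - A x := by
    simpa only [vsub_eq_sub, add_sub_cancel_left] using A.linearMap_vsub (x + v) x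
  calc ‖A.linear v‖ ^ 2 ≤ (‖A (x + v)‖ + ‖A x‖) ^ 2 := by rw [hv]; gcongr; exact norm_sub_le _ _
    _ ≤ 2 * (‖A (x + v)‖ ^ 2 + ‖A x‖ ^ 2) := add_sq_le

theorem ball_half_subset_preimage_add {E : Type*} [NormedAddCommGroup E] {c v : E} {r : ℝ}
    (hv : ‖v‖ ≤ r / 2) :
    Metric.ball c (r / 2) ⊆ (· + v) ⁻¹' Metric.ball c r := fun x hx => by
  rw [Metric.mem_ball, dist_eq_norm] at hx
  rw [Set.mem_preimage, Metric.mem_ball, dist_eq_norm, add_sub_right_comm]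
  linarith [norm_add_le (x - c) v]

section Translation

variable {E : Type*} [NormedAddCommGroup E] [MeasurableSpace E] [BorelSpace E] {ν : Measure E}
  [ν.IsAddRightInvariant] {f : E → ℝ} {c v : E} {r : ℝ}

theorem integrableOn_preimage_add {s : Set E} (hf : IntegrableOn f s ν) :
    IntegrableOn (fun x => f (x + v)) ((· + v) ⁻¹' s) ν :=
  ((measurePreserving_add_right ν v).integrableOn_comp_preimage (measurableEmbedding_addRight v)).2
    hf

theorem setIntegral_ball_half_add_le (hf : IntegrableOn f (Metric.ball c r) ν) (hf0 : 0 ≤ f)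
    (hv : ‖v‖ ≤ r / 2) :
    ∫ x in Metric.ball c (r / 2), f (x + v) ∂ν ≤ ∫ x in Metric.ball c r, f x ∂ν :=
  calc ∫ x in Metric.ball c (r / 2), f (x + v) ∂ν
      ≤ ∫ x in (· + v) ⁻¹' Metric.ball c r, f (x + v) ∂ν :=
        setIntegral_mono_set (integrableOn_preimage_add hf) (.of_forall fun x => hf0 (x + v))
          (ball_half_subset_preimage_add hv).eventuallyLE
    _ = ∫ x in Metric.ball c r, f x ∂ν :=
        (measurePreserving_add_right ν v).setIntegral_preimage_emb
          (measurableEmbedding_addRight v) f _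

end Translation

section Affine

variable {E F : Type*} [NormedAddCommGroup E] [NormedSpace ℝ E] [FiniteDimensional ℝ E]
  [MeasurableSpace E] [BorelSpace E] (ν : Measure E) [ν.IsAddHaarMeasure]
  [NormedAddCommGroup F] [NormedSpace ℝ F]

theorem measureReal_ball_mul_sq_norm_linear_le (A : E →ᵃ[ℝ] F) (c : E) {r : ℝ} {v : E}
    (hv : ‖v‖ ≤ r / 2) :
    ν.real (Metric.ball c (r / 2)) * ‖A.linear v‖ ^ 2 ≤
      4 * ∫ x in Metric.ball c r, ‖A x‖ ^ 2 ∂ν := by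
  have h0 : ‖(0 : E)‖ ≤ r / 2 := norm_zero.trans_le ((norm_nonneg v).trans hv)
  have hint : IntegrableOn (fun x => ‖A x‖ ^ 2) (Metric.ball c r) ν :=
    ((A.continuous_of_finiteDimensional.norm.pow 2).continuousOn.integrableOn_compact
      (isCompact_closedBall c r)).mono_set Metric.ball_subset_closedBall
  have hint' : ∀ w : E, ‖w‖ ≤ r / 2 →
      IntegrableOn (fun x => ‖A (x + w)‖ ^ 2) (Metric.ball c (r / 2)) ν := fun w hw =>
    (integrableOn_preimage_add hint).mono_set (ball_half_subset_preimage_add hw)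
  have hsum : IntegrableOn (fun x => ‖A (x + v)‖ ^ 2 + ‖A (x + 0)‖ ^ 2)
      (Metric.ball c (r / 2)) ν := (hint' v hv).add (hint' 0 h0)
  have hle : ∀ w : E, ‖w‖ ≤ r / 2 → ∫ x in Metric.ball c (r / 2), ‖A (x + w)‖ ^ 2 ∂ν ≤
      ∫ x in Metric.ball c r, ‖A x‖ ^ 2 ∂ν := fun w hw =>
    setIntegral_ball_half_add_le hint (fun _ => sq_nonneg _) hw
  calc ν.real (Metric.ball c (r / 2)) * ‖A.linear v‖ ^ 2
      = ∫ _ in Metric.ball c (r / 2), ‖A.linear v‖ ^ 2 ∂ν := by rw [setIntegral_const, smul_eq_mul]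
    _ ≤ ∫ x in Metric.ball c (r / 2), 2 * (‖A (x + v)‖ ^ 2 + ‖A (x + 0)‖ ^ 2) ∂ν :=
        setIntegral_mono (integrableOn_const measure_ball_lt_top.ne) (hsum.const_mul 2)
          fun x => by simpa only [add_zero] using sq_norm_linear_le A x v
    _ = 2 * (∫ x in Metric.ball c (r / 2), ‖A (x + v)‖ ^ 2 ∂ν
          + ∫ x in Metric.ball c (r / 2), ‖A (x + 0)‖ ^ 2 ∂ν) := by
        rw [integral_const_mul, integral_add (hint' v hv) (hint' 0 h0)]
    _ ≤ 4 * ∫ x in Metric.ball c r, ‖A x‖ ^ 2 ∂ν := by linarith [hle v hv, hle 0 h0]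

theorem measureReal_le_of_diam_le {S : Set E} (hS : Bornology.IsBounded S) {h r : ℝ}
    (hdiam : Metric.diam S ≤ h) (hr : 0 < r) (c : E) :
    ν.real S ≤ (h / r) ^ Module.finrank ℝ E * ν.real (Metric.ball c r) := by
  have hh : 0 ≤ h := Metric.diam_nonneg.trans hdiam
  rcases S.eq_empty_or_nonempty with rfl | ⟨p, hp⟩
  · rw [measureReal_empty]
    positivity
  have hsub : S ⊆ Metric.closedBall p h := fun x hx =>
    (Metric.dist_le_diam_of_mem hS hx hp).trans hdiam
  refine (measureReal_mono hsub measure_closedBall_lt_top.ne).trans_eq ?_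
  have hball : ν.real (Metric.ball c r) =
      r ^ Module.finrank ℝ E * ν.real (Metric.ball (0 : E) 1) := by
    rw [measureReal_def, Measure.addHaar_ball_of_pos ν c hr, ENNReal.toReal_mul,
      ENNReal.toReal_ofReal (by positivity), measureReal_def]
  rw [Measure.addHaar_real_closedBall ν p hh, hball, div_pow, ← mul_assoc,
    div_mul_cancel₀ _ (pow_pos hr _).ne']

theorem measureReal_mul_sq_norm_linear_le (A : E →ᵃ[ℝ] F) {S : Set E} (hS : IsCompact S)
    {κ h : ℝ} (hκ : 0 < κ) (hh : 0 < h) (hdiam : Metric.diam S ≤ h) {c : E}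
    (hball : Metric.ball c (κ * h) ⊆ S) {v : E} (hv : ‖v‖ ≤ 1) :
    ν.real S * ‖A.linear v‖ ^ 2 ≤
      16 * 2 ^ Module.finrank ℝ E / κ ^ (Module.finrank ℝ E + 2) * (h ^ 2)⁻¹ *
        ∫ x in S, ‖A x‖ ^ 2 ∂ν := by
  have hr : 0 < κ * h / 2 := by positivity
  have hr2 : ‖(κ * h / 2) • v‖ ≤ κ * h / 2 := by
    rw [norm_smul, Real.norm_of_nonneg hr.le]
    exact mul_le_of_le_one_right hr.le hv
  have hint : IntegrableOn (fun x => ‖A x‖ ^ 2) S ν :=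
    (A.continuous_of_finiteDimensional.norm.pow 2).continuousOn.integrableOn_compact hS
  set n := Module.finrank ℝ E
  calc ν.real S * ‖A.linear v‖ ^ 2
      ≤ (h / (κ * h / 2)) ^ n * ν.real (Metric.ball c (κ * h / 2)) * ‖A.linear v‖ ^ 2 := by
        gcongr
        exact measureReal_le_of_diam_le ν hS.isBounded hdiam hr c
    _ = (2 / κ) ^ n * (4 / (κ * h) ^ 2) *
          (ν.real (Metric.ball c (κ * h / 2)) * ‖A.linear ((κ * h / 2) • v)‖ ^ 2) := by
        rw [map_smul, norm_smul, Real.norm_of_nonneg hr.le,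
          show h / (κ * h / 2) = 2 / κ by field_simp]
        field_simp
        ring
    _ ≤ (2 / κ) ^ n * (4 / (κ * h) ^ 2) * (4 * ∫ x in Metric.ball c (κ * h), ‖A x‖ ^ 2 ∂ν) := by
        gcongr (2 / κ) ^ n * (4 / (κ * h) ^ 2) * ?_
        exact measureReal_ball_mul_sq_norm_linear_le ν A c hr2
    _ ≤ (2 / κ) ^ n * (4 / (κ * h) ^ 2) * (4 * ∫ x in S, ‖A x‖ ^ 2 ∂ν) := by
        gcongr (2 / κ) ^ n * (4 / (κ * h) ^ 2) * (4 * ?_)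
        exact setIntegral_mono_set hint (.of_forall fun _ => sq_nonneg _) hball.eventuallyLE
    _ = 16 * 2 ^ n / κ ^ (n + 2) * (h ^ 2)⁻¹ * ∫ x in S, ‖A x‖ ^ 2 ∂ν := by
        rw [div_pow, pow_add]
        field_simp
        ring

end Affine

variable {F : Type*} [NormedAddCommGroup F] [InnerProductSpace ℝ F] {T : SimplicialComplex ℝ R3}
  {Ω : Set R3}

theorem diam_cell_pos {K : Finset R3} (hK : K ∈ cells T) :
    0 < Metric.diam (convexHull ℝ (K : Set R3)) := by
  obtain ⟨p, hp, q, hq, hpq⟩ := Finset.one_lt_card.1 (hK.2 ▸ by norm_num : 1 < K.card)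
  exact (dist_pos.2 hpq).trans_le (Metric.dist_le_diam_of_mem
    (isCompact_convexHull_finset K).isBounded (subset_convexHull ℝ _ hp)
    (subset_convexHull ℝ _ hq))

theorem setIntegral_cellInterior_sq_norm_pderiv_le {κ h : ℝ} (hκ : 0 < κ) {K : Finset R3}
    (hK : K ∈ cells T) (hdiam : Metric.diam (convexHull ℝ (K : Set R3)) ≤ h) {c : R3}
    (hball : Metric.ball c (κ * h) ⊆ convexHull ℝ (K : Set R3)) {u : R3 → F} {A : R3 →ᵃ[ℝ] F}
    (hA : Set.EqOn u A (cellInterior K)) (i : Fin 3) :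
    ∫ x in cellInterior K, ‖pderiv i u x‖ ^ 2 ≤
      128 / κ ^ 5 * (h ^ 2)⁻¹ * ∫ x in cellInterior K, ‖u x‖ ^ 2 := by
  have hmeas := (isOpen_cellInterior K).measurableSet
  have hpderiv : ∫ x in cellInterior K, ‖pderiv i u x‖ ^ 2 =
      volume.real (convexHull ℝ (K : Set R3)) * ‖A.linear (EuclideanSpace.single i 1)‖ ^ 2 := by
    rw [setIntegral_congr_fun hmeas fun x hx => by rw [pderiv_of_eqOn_cellInterior hA i hx],
      setIntegral_const, smul_eq_mul, measureReal_congr (cellInterior_ae_eq K)]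
  have hu : ∫ x in cellInterior K, ‖u x‖ ^ 2 = ∫ x in convexHull ℝ (K : Set R3), ‖A x‖ ^ 2 := by
    rw [← setIntegral_congr_set (cellInterior_ae_eq K)]
    exact setIntegral_congr_fun hmeas fun x hx => by simp only [hA hx]
  rw [hpderiv, hu]
  have hle := measureReal_mul_sq_norm_linear_le volume A (isCompact_convexHull_finset K) hκ
    ((diam_cell_pos hK).trans_le hdiam) hdiam hball (v := EuclideanSpace.single i 1) (by simp)
  rw [finrank_euclideanSpace_fin] at hle
  norm_num at hle ⊢
  exact hle

theorem IsP1.gradNormSq_le (hT : IsTetrahedrization T Ω) {κ h : ℝ} (hκ : 0 < κ)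
    (hdiam : ∀ K ∈ cells T, Metric.diam (convexHull ℝ (K : Set R3)) ≤ h)
    (hreg : IsRegularMesh κ h T) {u : R3 → F} (hu : IsP1 T u) :
    gradNormSq Ω u ≤ 384 / κ ^ 5 * (h ^ 2)⁻¹ * normSq Ω u := by
  have hcells : ∀ {f : R3 → F}, MemLp f 2 (volume.restrict Ω) →
      normSq Ω f = ∑ K ∈ hT.finite_cells.toFinset, ∫ x in cellInterior K, ‖f x‖ ^ 2 := fun hf => by
    rw [normSq, ip, hT.integral_eq_sum (integrable_inner_of_memLp hf hf)]
    simp only [real_inner_self_eq_norm_sq]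
  have hi : ∀ i, normSq Ω (pderiv i u) ≤ 128 / κ ^ 5 * (h ^ 2)⁻¹ * normSq Ω u := fun i => by
    rw [hcells ((hu.hasL2Deriv hT).memLp i), hcells (hu.memLp hT), Finset.mul_sum]
    refine Finset.sum_le_sum fun K hK => ?_
    rw [hT.finite_cells.mem_toFinset] at hK
    obtain ⟨A, hA⟩ := hu.mem_cellwiseAffine K hK
    obtain ⟨c, hc⟩ := hreg K hK
    exact setIntegral_cellInterior_sq_norm_pderiv_le hκ hK (hdiam K hK) hc hA i
  calc gradNormSq Ω u = ∑ i, normSq Ω (pderiv i u) := rfl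
    _ ≤ ∑ _i : Fin 3, 128 / κ ^ 5 * (h ^ 2)⁻¹ * normSq Ω u := Finset.sum_le_sum fun i _ => hi i
    _ = 384 / κ ^ 5 * (h ^ 2)⁻¹ * normSq Ω u := by
      rw [Finset.sum_const, Finset.card_univ, Fintype.card_fin, nsmul_eq_mul]
      push_cast
      ring

end InverseEstimate

/-! ### The energy balance of one step -/

section TimeDifferences

variable {Ω : Set R3} {H : ℕ → R3 → R3} {k : ℝ} {j : ℕ}

theorem half_eq_smul (H : ℕ → R3 → R3) (j : ℕ) : half H j = (2⁻¹ : ℝ) • (H (j + 1) + H j) := rfl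

theorem dt_succ_eq_smul (k : ℝ) (H : ℕ → R3 → R3) (j : ℕ) :
    dt k H (j + 1) = k⁻¹ • (H (j + 1) - H j) := rfl

theorem two_mul_ip_dt_half (hk : k ≠ 0) (h₀ : MemLp (H j) 2 (volume.restrict Ω))
    (h₁ : MemLp (H (j + 1)) 2 (volume.restrict Ω)) :
    2 * k * ip Ω (dt k H (j + 1)) (half H j) = normSq Ω (H (j + 1)) - normSq Ω (H j) := by
  rw [dt_succ_eq_smul, half_eq_smul, ip_smul_left, ip_comm, ip_smul_left, ip_comm, ip_sub_add h₁ h₀]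
  field_simp

theorem two_mul_ip_curl_dt_curl_half (hk : k ≠ 0) (h₀ : HasL2Deriv Ω (H j))
    (h₁ : HasL2Deriv Ω (H (j + 1))) :
    2 * k * ip Ω (curl (dt k H (j + 1))) (curl (half H j)) =
      normSq Ω (curl (H (j + 1))) - normSq Ω (curl (H j)) := by
  rw [dt_succ_eq_smul, half_eq_smul, curl_smul, curl_smul, ip_smul_left, ip_comm, ip_smul_left,
    ip_comm, ip_congr (h₁.curl_sub_ae h₀) (h₁.curl_add_ae h₀),
    ip_sub_add h₁.memLp_curl h₀.memLp_curl]
  field_simp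

end TimeDifferences

section Normalization

variable {F : Type*} [NormedAddCommGroup F] [InnerProductSpace ℝ F]

theorem norm_le_norm_add_smul {x y : F} (hxy : inner ℝ y x = 0) (c : ℝ) :
    ‖x‖ ≤ ‖x + c • y‖ := by
  refine le_of_sq_le_sq ?_ (norm_nonneg _)
  rw [norm_add_sq_real, real_inner_smul_right, real_inner_comm, hxy, mul_zero, mul_zero, add_zero]
  exact le_add_of_nonneg_right (sq_nonneg _)

theorem inner_cross_right_self (u v : R3) : inner ℝ (cross u v) v = 0 := by
  simp [cross, EuclideanSpace.inner_eq_star_dotProduct]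

end Normalization

namespace IsSchemeOutput

variable {Dt D : Set R3} {T : SimplicialComplex ℝ R3} {lam₁ lam₂ μ σ μ₀ θ k : ℝ} {J j : ℕ}
  {m₀ H₀ : R3 → R3} {m v H : ℕ → R3 → R3}

theorem isP1 (hs : IsSchemeOutput Dt D T lam₁ lam₂ μ σ μ₀ θ k J m₀ H₀ m v H) (hj : j ≤ J) :
    IsP1 (MLLG.restrict T D) (m j) := by
  cases j with
  | zero => exact hs.init_m.isP1
  | succ j => exact (hs.update j hj).isP1

theorem isEdgeElement (hs : IsSchemeOutput Dt D T lam₁ lam₂ μ σ μ₀ θ k J m₀ H₀ m v H)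
    (hj : j ≤ J) : IsEdgeElement T (H j) := by
  cases j with
  | zero => exact ⟨_, hs.init_H⟩
  | succ j => exact hs.mem_H j hj

theorem one_le_norm (hs : IsSchemeOutput Dt D T lam₁ lam₂ μ σ μ₀ θ k J m₀ H₀ m v H)
    (hone : ∀ p ∈ (MLLG.restrict T D).vertices, 1 ≤ ‖m₀ p‖) (hj : j ≤ J) {p : R3}
    (hp : p ∈ (MLLG.restrict T D).vertices) : 1 ≤ ‖m j p‖ := by
  induction j with
  | zero => exact hs.init_m.nodal p hp ▸ hone p hp
  | succ j ih =>
    have hpos : 0 < ‖m j p + k • v (j + 1) p‖ :=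
      (zero_lt_one.trans_le (ih (Nat.le_of_succ_le hj))).trans_le
        (norm_le_norm_add_smul ((hs.mem_v j hj).orth p hp) k)
    rw [(hs.update j hj).nodal p hp, norm_smul, norm_inv, norm_norm, inv_mul_cancel₀ hpos.ne']

theorem gradNormSq_succ_le (hs : IsSchemeOutput Dt D T lam₁ lam₂ μ σ μ₀ θ k J m₀ H₀ m v H)
    (hT : IsTetrahedrization (MLLG.restrict T D) D)
    (hst : HasNonposStiffness (MLLG.restrict T D) D)
    (hone : ∀ p ∈ (MLLG.restrict T D).vertices, 1 ≤ ‖m₀ p‖) (hj : j < J) :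
    gradNormSq D (m (j + 1)) ≤ gradNormSq D (m j + k • v (j + 1)) := by
  have hv := hs.mem_v j hj
  have hup := hs.update j hj
  have hmv : m j + k • v (j + 1) ∈ p1Space (MLLG.restrict T D) R3 :=
    Submodule.add_mem _ (hs.isP1 hj.le) (Submodule.smul_mem _ k hv.isP1)
  have hge : ∀ p ∈ (MLLG.restrict T D).vertices, 1 ≤ ‖m j p + k • v (j + 1) p‖ := fun p hp =>
    (hs.one_le_norm hone hj.le hp).trans (norm_le_norm_add_smul (hv.orth p hp) k)
  refine gradNormSq_le_of_nodal hT hst hmv hup.isP1 fun p hp q hq => ?_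
  rw [hup.nodal p hp, hup.nodal q hq]
  exact norm_normalize_sub_le (hge p hp) (hge q hq)

theorem mul_normSq_eq (hs : IsSchemeOutput Dt D T lam₁ lam₂ μ σ μ₀ θ k J m₀ H₀ m v H)
    (hT : IsTetrahedrization (MLLG.restrict T D) D) (hj : j < J) :
    lam₂ * normSq D (v (j + 1)) =
      -μ * (gradIp D (m j) (v (j + 1)) + k * θ * gradNormSq D (v (j + 1)))
        + μ * ip D (half H j) (v (j + 1)) := by
  have hv := hs.mem_v j hj
  have hdm := (hs.isP1 hj.le).hasL2Deriv hT
  have hdv := hv.isP1.hasL2Deriv hT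
  have hcross : ip D (fun x => cross (m j x) (v (j + 1) x)) (v (j + 1)) = 0 := by
    simp only [ip, inner_cross_right_self, integral_zero]
  have hgrad : gradIp D (fun x => m j x + (k * θ) • v (j + 1) x) (v (j + 1)) =
      gradIp D (m j) (v (j + 1)) + k * θ * gradNormSq D (v (j + 1)) :=
    (gradIp_add_left hdm (hdv.smul (k * θ)) hdv).trans (by rw [gradIp_smul_left, gradNormSq])
  have hllg := hs.llg j hj _ hv
  rwa [hcross, mul_zero, sub_zero, hgrad] at hllg

theorem exchange_energy_le (hs : IsSchemeOutput Dt D T lam₁ lam₂ μ σ μ₀ θ k J m₀ H₀ m v H)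
    (hT : IsTetrahedrization (MLLG.restrict T D) D)
    (hst : HasNonposStiffness (MLLG.restrict T D) D)
    (hone : ∀ p ∈ (MLLG.restrict T D).vertices, 1 ≤ ‖m₀ p‖) (hμ : μ ≠ 0) (hj : j < J) :
    gradNormSq D (m (j + 1)) + 2 * (lam₂ * μ⁻¹) * (k * normSq D (v (j + 1))) ≤
      gradNormSq D (m j) + 2 * k * ip D (v (j + 1)) (half H j)
        + (1 - 2 * θ) * k ^ 2 * gradNormSq D (v (j + 1)) := by
  have hexp := gradNormSq_add_smul ((hs.isP1 hj.le).hasL2Deriv hT)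
    ((hs.mem_v j hj).isP1.hasL2Deriv hT) k
  have hgrad : gradIp D (m j) (v (j + 1)) = ip D (v (j + 1)) (half H j)
      - lam₂ * μ⁻¹ * normSq D (v (j + 1)) - k * θ * gradNormSq D (v (j + 1)) := by
    have hllg := hs.mul_normSq_eq hT hj
    rw [ip_comm D (half H j)] at hllg
    field_simp
    linarith
  rw [hgrad] at hexp
  linarith [hs.gradNormSq_succ_le hT hst hone hj]

theorem magnetic_energy_eq (hs : IsSchemeOutput Dt D T lam₁ lam₂ μ σ μ₀ θ k J m₀ H₀ m v H)
    (hTt : IsTetrahedrization T Dt) (hT : IsTetrahedrization (MLLG.restrict T D) D)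
    (hμ₀ : μ₀ ≠ 0) (hk : k ≠ 0) (hj : j < J) :
    normSq Dt (H (j + 1)) + 2 * μ₀⁻¹ * σ * (k * normSq Dt (curl (half H j))) =
      normSq Dt (H j) - 2 * k * ip D (v (j + 1)) (half H j) := by
  have h₀ := hs.isEdgeElement hj.le
  have h₁ := hs.mem_H j hj
  have hhalf : half H j ∈ edgeSpace T := Submodule.smul_mem _ _ (Submodule.add_mem _ h₁ h₀)
  have hmaxwell := hs.maxwell j hj _ hhalf
  rw [ip_indicator_left hT.isOpen.measurableSet (hTt.subset_of_restrict hT)] at hmaxwell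
  have hdt := two_mul_ip_dt_half hk (h₀.memLp hTt) (h₁.memLp hTt)
  have hip : ip Dt (dt k H (j + 1)) (half H j) =
      -ip D (v (j + 1)) (half H j) - μ₀⁻¹ * σ * normSq Dt (curl (half H j)) := by
    rw [normSq]
    field_simp
    linarith
  rw [hip] at hdt
  linarith

theorem curl_energy_le (hs : IsSchemeOutput Dt D T lam₁ lam₂ μ σ μ₀ θ k J m₀ H₀ m v H)
    (hTt : IsTetrahedrization T Dt) (hT : IsTetrahedrization (MLLG.restrict T D) D)
    (hμ₀ : μ₀ ≠ 0) (hk : 0 < k) (hj : j < J) :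
    k * normSq Dt (dt k H (j + 1)) + μ₀⁻¹ * σ * normSq Dt (curl (H (j + 1))) ≤
      k * normSq D (v (j + 1)) + μ₀⁻¹ * σ * normSq Dt (curl (H j)) := by
  have h₀ := hs.isEdgeElement hj.le
  have h₁ := hs.mem_H j hj
  have hD := hTt.subset_of_restrict hT
  have hdt : dt k H (j + 1) ∈ edgeSpace T := Submodule.smul_mem _ _ (Submodule.sub_mem _ h₁ h₀)
  have hdtL := IsEdgeElement.memLp hTt hdt
  have hmaxwell := hs.maxwell j hj _ hdt
  rw [ip_indicator_left hT.isOpen.measurableSet hD, ip_comm Dt (curl (half H j))] at hmaxwell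
  have hcurl := two_mul_ip_curl_dt_curl_half hk.ne' (h₀.hasL2Deriv hTt) (h₁.hasL2Deriv hTt)
  have hyoung : -(2 * ip D (v (j + 1)) (dt k H (j + 1))) ≤
      normSq D (v (j + 1)) + normSq Dt (dt k H (j + 1)) :=
    (neg_two_mul_ip_le ((hs.mem_v j hj).isP1.memLp hT)
      (hdtL.mono_measure (Measure.restrict_mono hD le_rfl))).trans
      (add_le_add_right (normSq_mono hD hdtL) _)
  have hip : normSq Dt (dt k H (j + 1)) = -ip D (v (j + 1)) (dt k H (j + 1))
      - μ₀⁻¹ * σ * ip Dt (curl (dt k H (j + 1))) (curl (half H j)) := by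
    rw [normSq]
    field_simp
    linarith
  linear_combination k * hyoung + 2 * k * hip - μ₀⁻¹ * σ * hcurl

theorem energy_succ_le (hs : IsSchemeOutput Dt D T lam₁ lam₂ μ σ μ₀ θ k J m₀ H₀ m v H)
    (hTt : IsTetrahedrization T Dt) (hT : IsTetrahedrization (MLLG.restrict T D) D)
    (hst : HasNonposStiffness (MLLG.restrict T D) D)
    (hone : ∀ p ∈ (MLLG.restrict T D).vertices, 1 ≤ ‖m₀ p‖) (hlam₂ : 0 ≤ lam₂) (hμ : 0 < μ)
    (hμ₀ : μ₀ ≠ 0) (hk : 0 < k) (hj : j < J) :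
    energy Dt D lam₂ μ σ μ₀ (m (j + 1)) (H (j + 1))
      + lam₂ * μ⁻¹ * (k * normSq D (v (j + 1)))
      + lam₂ * μ⁻¹ * (k * normSq Dt (dt k H (j + 1)))
      + 2 * μ₀⁻¹ * σ * (k * normSq Dt (curl (half H j))) ≤
    energy Dt D lam₂ μ σ μ₀ (m j) (H j)
      + (1 - 2 * θ) * k ^ 2 * gradNormSq D (v (j + 1)) := by
  have hexchange := hs.exchange_energy_le hT hst hone hμ.ne' hj
  have hmagnetic := hs.magnetic_energy_eq hTt hT hμ₀ hk.ne' hj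
  have hcurl := mul_le_mul_of_nonneg_left (hs.curl_energy_le hTt hT hμ₀ hk hj)
    (mul_nonneg hlam₂ (inv_nonneg.2 hμ.le))
  simp only [energy]
  linarith

end IsSchemeOutput

section InitialData

variable {T : SimplicialComplex ℝ R3} {D : Set R3} {F : Type*} [NormedAddCommGroup F]

theorem mem_closure_of_mem_vertices_restrict {p : R3} (hp : p ∈ (restrict T D).vertices) :
    p ∈ closure D :=
  hp.2 (subset_convexHull ℝ _ (by simp))

theorem norm_eq_of_ae {f : R3 → F} {c : ℝ} (hD : IsOpen D) (hf : ContinuousOn f (closure D))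
    (h : ∀ᵐ x ∂volume.restrict D, ‖f x‖ = c) {x : R3} (hx : x ∈ closure D) : ‖f x‖ = c :=
  (Measure.eqOn_open_of_ae_eq h hD (hf.mono subset_closure).norm
    continuousOn_const).of_subset_closure hf.norm continuousOn_const subset_closure subset_rfl hx

end InitialData

theorem explicit_error_le {a g n k θ C h : ℝ} (hg : 0 ≤ g) (hgn : g ≤ C * (h ^ 2)⁻¹ * n) :
    (1 - 2 * θ) * k ^ 2 * g ≤
      (a - if 1 / 2 ≤ θ then a else a - (1 - 2 * θ) * C * k * (h ^ 2)⁻¹) * (k * n) := by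
  split_ifs with hθ
  · rw [sub_self, zero_mul]
    exact mul_nonpos_of_nonpos_of_nonneg
      (mul_nonpos_of_nonpos_of_nonneg (by linarith) (sq_nonneg k)) hg
  · have hθ' : 0 ≤ (1 - 2 * θ) * k ^ 2 := mul_nonneg (by linarith) (sq_nonneg k)
    exact (mul_le_mul_of_nonneg_left hgn hθ').trans_eq (by ring)

end MLLG

theorem lemma4p1_general {κ : ℝ} (hκ : 0 < κ) {Dt D : Set MLLG.R3}
    {T : Geometry.SimplicialComplex ℝ MLLG.R3} {h : ℝ} (hTt : MLLG.IsTetrahedrization T Dt)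
    (hT : MLLG.IsTetrahedrization (MLLG.restrict T D) D)
    (hdiam : ∀ K ∈ MLLG.cells (MLLG.restrict T D),
      Metric.diam (convexHull ℝ (K : Set MLLG.R3)) ≤ h)
    (hreg : MLLG.IsRegularMesh κ h (MLLG.restrict T D))
    (hst : MLLG.HasNonposStiffness (MLLG.restrict T D) D)
    {lam₁ lam₂ σ μ₀ μ θ k : ℝ} (hlam₂ : 0 ≤ lam₂) (hμ₀ : μ₀ ≠ 0) (hμ : 0 < μ) (hk : 0 < k)
    {J : ℕ} {m₀ H₀ : MLLG.R3 → MLLG.R3}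
    (hone : ∀ p ∈ (MLLG.restrict T D).vertices, 1 ≤ ‖m₀ p‖) {m v H : ℕ → MLLG.R3 → MLLG.R3}
    (hs : MLLG.IsSchemeOutput Dt D T lam₁ lam₂ μ σ μ₀ θ k J m₀ H₀ m v H) {j : ℕ} (hj : j ≤ J) :
    MLLG.energy Dt D lam₂ μ σ μ₀ (m j) (H j)
      + (if 1 / 2 ≤ θ then lam₂ * μ⁻¹
          else lam₂ * μ⁻¹ - (1 - 2 * θ) * (384 / κ ^ 5) * k * (h ^ 2)⁻¹)
        * ∑ i ∈ Finset.range j, k * MLLG.normSq D (v (i + 1))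
      + lam₂ * μ⁻¹ * ∑ i ∈ Finset.range j, k * MLLG.normSq Dt (MLLG.dt k H (i + 1))
      + 2 * μ₀⁻¹ * σ * ∑ i ∈ Finset.range j, k * MLLG.normSq Dt (MLLG.curl (MLLG.half H i))
    ≤ MLLG.energy Dt D lam₂ μ σ μ₀ (m 0) (H 0) := by
  induction j with
  | zero => simp
  | succ j ih =>
    have henergy := hs.energy_succ_le hTt hT hst hone hlam₂ hμ hμ₀ hk hj
    have htheta := MLLG.explicit_error_le (a := lam₂ * μ⁻¹) (k := k) (θ := θ)
      (MLLG.gradNormSq_nonneg D (v (j + 1)))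
      ((hs.mem_v j hj).isP1.gradNormSq_le hT hκ hdiam hreg)
    simp only [Finset.sum_range_succ]
    linarith [ih (Nat.le_of_succ_le hj)]

theorem lemma4p1 (κ : ℝ) (hκ : 0 < κ) :
    ∃ C₁ : ℝ, 0 < C₁ ∧
      ∀ (Dt D : Set MLLG.R3) (T : Geometry.SimplicialComplex ℝ MLLG.R3) (h : ℝ),
        D ⊆ Dt →
        MLLG.IsTetrahedrization T Dt →
        MLLG.IsTetrahedrization (MLLG.restrict T D) D →
        MLLG.IsMeshSize T h →
        MLLG.IsRegularMesh κ h T →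
        MLLG.HasNonposStiffness (MLLG.restrict T D) D →
      ∀ (lam₁ lam₂ σ μ₀ μ : ℝ), lam₁ ≠ 0 → 0 < lam₂ → 0 ≤ σ → 0 < μ₀ →
        μ = lam₁ ^ 2 + lam₂ ^ 2 →
      ∀ (θ : ℝ), 0 ≤ θ → θ ≤ 1 →
      ∀ (tEnd k : ℝ) (J : ℕ), 0 < tEnd → 0 < J → k = tEnd / J →
      ∀ (m₀ H₀ : MLLG.R3 → MLLG.R3),
        ContinuousOn m₀ (closure D) →
        (∀ᵐ x ∂(MeasureTheory.volume.restrict D), ‖m₀ x‖ = 1) →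
        MLLG.HasEdgeTraces T H₀ →
      ∀ (m v H : ℕ → MLLG.R3 → MLLG.R3),
        MLLG.IsSchemeOutput Dt D T lam₁ lam₂ μ σ μ₀ θ k J m₀ H₀ m v H →
      ∀ j ≤ J,
        MLLG.energy Dt D lam₂ μ σ μ₀ (m j) (H j)
          + (if 1 / 2 ≤ θ then lam₂ * μ⁻¹
              else lam₂ * μ⁻¹ - (1 - 2 * θ) * C₁ * k * (h ^ 2)⁻¹)
            * ∑ i ∈ Finset.range j, k * MLLG.normSq D (v (i + 1))
          + lam₂ * μ⁻¹ * ∑ i ∈ Finset.range j, k * MLLG.normSq Dt (MLLG.dt k H (i + 1))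
          + 2 * μ₀⁻¹ * σ
            * ∑ i ∈ Finset.range j, k * MLLG.normSq Dt (MLLG.curl (MLLG.half H i))
        ≤ MLLG.energy Dt D lam₂ μ σ μ₀ (m 0) (H 0) := by
  refine ⟨384 / κ ^ 5, by positivity, ?_⟩
  intro Dt D T h _ hTt hT hmesh hreg hst lam₁ lam₂ σ μ₀ μ _ hlam₂ _ hμ₀ hμ θ _ _ tEnd k J htEnd hJ
    hk m₀ H₀ hm₀ hm₀_norm _ m v H hs j hj
  have hkpos : 0 < k := hk ▸ div_pos htEnd (Nat.cast_pos.2 hJ)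
  have hμpos : 0 < μ := by rw [hμ]; positivity
  have hcells := MLLG.cells_restrict_subset T D
  exact lemma4p1_general hκ hTt hT (fun K hK => hmesh.2 ⟨K, hcells hK, rfl⟩)
    (fun K hK => hreg K (hcells hK)) hst hlam₂.le hμ₀.ne' hμpos hkpos
    (fun p hp => (MLLG.norm_eq_of_ae hT.isOpen hm₀ hm₀_norm
      (MLLG.mem_closure_of_mem_vertices_restrict hp)).ge) hs hj
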